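/- **Theorem 1.2.** Let $\Lambda$ be a lattice in $\mathbb{R}^d$ (a discrete subgroup spanning $\mathbb{R}^d$), with dual lattice $\Lambda^*=\{\nu\in\mathbb{R}^d : \mu\cdot\nu\in\mathbb{Z}\ \text{for all } \mu\in\Lambda\}$, and let $U\subseteq\mathbb{R}^d$ be an open convex neighbourhood of the origin such that $U\cap\Lambda^*=\{0\}$. Let $\Omega\subseteq\mathbb{R}^d$ be open and let $f\in\mathcal{D}'(\Omega)$ be a distribution. For an open set $W$, let $\mathcal{E}'(W)$ be the space of compactly supported distributions on $W$, that is, the strong dual of $C^\infty(W)$, and for $g\in\mathcal{E}'(W)$ put $\widehat g(\xi)=\langle g(x),e^{-2\pi i x\cdot\xi}\rangle$. The analytic wave front set $WF_A(f)$ is the set of all $(x_0,\xi_0)\in\Omega\times(\mathbb{R}^d\setminus\{0\})$ for which there do **not** exist an open conic neighbourhood $\Gamma$ of $\xi_0$, an open neighbourhood $V\subseteq\Omega$ of $x_0$, a bounded sequence $(f_p)_{p\in\mathbb{N}}$ in $\mathcal{E}'(\Omega)$ with $f_p=f$ on $V$ for all $p\in\mathbb{N}$, and constants $A,C>0$ such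 that $$\sup_{\xi\in\Gamma}|\widehat{f_p}(\xi)|\,|\xi|^p\le A\,C^p\,p!\qquad\text{for all } p\in\mathbb{N}.$$ Then $WF_A(f)$ coincides with the complement in $\Omega\times(\mathbb{R}^d\setminus\{0\})$ of the set of points $(x_0,\xi_0)$ for which there are an open neighbourhood $V\subseteq\Omega\cap(x_0+U)$ of $x_0$, an open conic neighbourhood $\Gamma$ of $\xi_0$, and a bounded sequence $(f_p)_{p\in\mathbb{N}}$ in $\mathcal{E}'(\Omega\cap(x_0+U))$, with $f_p=f$ on $V$ for all $p\in\mathbb{N}$, such that for some $h>0$ $$\sup_{\mu\in\Gamma\cap\Lambda}|\widehat{f_p}(\mu)|\,|\mu|^p\le h^{p+1}\,p!\qquad\text{for all } p\in\mathbb{N}.$$ -/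

import Mathlib

open TopologicalSpace Set
open scoped Distributions ContDiff Pointwise

noncomputable section

section SmoothFunctions

variable {E : Type*} [NormedAddCommGroup E] [NormedSpace ℝ E]

/-- The complex vector space of smooth functions `W → ℂ` on an open set `W`. A function on `W` is
represented by its extension by zero to the whole space. -/
def smoothSubmodule (W : Opens E) : Submodule ℂ (E → ℂ) where
  carrier := {φ | ContDiffOn ℝ ∞ φ W ∧ ∀ x ∉ W, φ x = 0}
  add_mem' := by
    rintro φ ψ ⟨h1, h2⟩ ⟨h3, h4⟩
    exact ⟨h1.add h3, fun x hx => by simp [h2 x hx, h4 x hx]⟩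
  zero_mem' := ⟨contDiffOn_const, fun _ _ => rfl⟩
  smul_mem' := by
    rintro c φ ⟨h1, h2⟩
    exact ⟨h1.const_smul c, fun x hx => by simp [h2 x hx]⟩

/-- The space `𝓔(W) = C^∞(W)` of complex-valued smooth functions on an open set `W`; it carries the
topology of uniform convergence of all derivatives on the compact subsets of `W`, see below. -/
def SmoothFunctions (W : Opens E) : Type _ := ↥(smoothSubmodule W)

namespace SmoothFunctions

variable {W : Opens E}

instance : AddCommGroup (SmoothFunctions W) := inferInstanceAs (AddCommGroup ↥(smoothSubmodule W))

instance : Module ℂ (SmoothFunctions W) := inferInstanceAs (Module ℂ ↥(smoothSubmodule W))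

instance : CoeFun (SmoothFunctions W) (fun _ => E → ℂ) := ⟨fun φ => φ.1⟩

theorem contDiffOn (φ : SmoothFunctions W) : ContDiffOn ℝ ∞ φ W := φ.2.1

theorem contDiffAt (φ : SmoothFunctions W) {x : E} (hx : x ∈ W) : ContDiffAt ℝ ∞ φ x :=
  φ.contDiffOn.contDiffAt (W.isOpen.mem_nhds hx)

/-- The restriction to `W` of a smooth function on the whole space. -/
def restrict (W : Opens E) (g : E → ℂ) (hg : ContDiff ℝ ∞ g) : SmoothFunctions W :=
  ⟨(W : Set E).indicator g,
    hg.contDiffOn.congr fun _ hx => indicator_of_mem hx g,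
    fun _ hx => indicator_of_notMem hx g⟩

theorem continuousOn_norm_iteratedFDeriv (φ : SmoothFunctions W) (n : ℕ) :
    ContinuousOn (fun x => ‖iteratedFDeriv ℝ n φ x‖) W := by
  have h := (φ.contDiffOn.continuousOn_iteratedFDerivWithin (m := n)
    (by exact_mod_cast le_top) W.isOpen.uniqueDiffOn).norm
  refine h.congr fun x hx => ?_
  simp only [iteratedFDerivWithin_of_isOpen n W.isOpen hx]

theorem bddAbove_range_norm (φ : SmoothFunctions W) (K : {K : Compacts E // (K : Set E) ⊆ W})
    (n : ℕ) : BddAbove (range fun x : (K.1 : Set E) => ‖iteratedFDeriv ℝ n φ x‖) := by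
  have h := K.1.isCompact.bddAbove_image ((φ.continuousOn_norm_iteratedFDeriv n).mono K.2)
  rwa [image_eq_range] at h

/-- The family of seminorms `φ ↦ sup_{x ∈ K} ‖D^n φ(x)‖`, for `K` a compact subset of `W` and `n` a
natural number; `D^n φ(x)` is the total derivative of order `n`. -/
def seminormFamily (W : Opens E) :
    SeminormFamily ℂ (SmoothFunctions W) ({K : Compacts E // (K : Set E) ⊆ W} × ℕ) := fun i =>
  Seminorm.of (fun φ => ⨆ x : (i.1.1 : Set E), ‖iteratedFDeriv ℝ i.2 φ x‖)
    (fun φ ψ => by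
      refine Real.iSup_le (fun x => ?_)
        (add_nonneg (Real.iSup_nonneg fun _ => norm_nonneg _)
          (Real.iSup_nonneg fun _ => norm_nonneg _))
      have hx : (x : E) ∈ W := i.1.2 x.2
      have h : iteratedFDeriv ℝ i.2 (φ + ψ : SmoothFunctions W) x
          = iteratedFDeriv ℝ i.2 φ x + iteratedFDeriv ℝ i.2 ψ x :=
        iteratedFDeriv_add_apply ((φ.contDiffAt hx).of_le (by exact_mod_cast le_top))
          ((ψ.contDiffAt hx).of_le (by exact_mod_cast le_top))
      rw [h]
      exact (norm_add_le _ _).trans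
        (add_le_add (le_ciSup (φ.bddAbove_range_norm i.1 i.2) x)
          (le_ciSup (ψ.bddAbove_range_norm i.1 i.2) x)))
    (fun c φ => by
      rw [Real.mul_iSup_of_nonneg (norm_nonneg c)]
      congr 1
      funext x
      have hx : (x : E) ∈ W := i.1.2 x.2
      have h : iteratedFDeriv ℝ i.2 (c • φ : SmoothFunctions W) x
          = c • iteratedFDeriv ℝ i.2 φ x :=
        iteratedFDeriv_const_smul_apply ((φ.contDiffAt hx).of_le (by exact_mod_cast le_top))
      rw [h, norm_smul])

theorem seminormFamily_apply (K : {K : Compacts E // (K : Set E) ⊆ W}) (n : ℕ)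
    (φ : SmoothFunctions W) :
    seminormFamily W (K, n) φ = ⨆ x : (K.1 : Set E), ‖iteratedFDeriv ℝ n φ x‖ := rfl

instance : Nonempty ({K : Compacts E // (K : Set E) ⊆ W} × ℕ) :=
  ⟨⟨⟨⊥, by simp⟩, 0⟩⟩

instance : TopologicalSpace (SmoothFunctions W) := (seminormFamily W).moduleFilterBasis.topology

theorem withSeminorms (W : Opens E) : WithSeminorms (seminormFamily W) := ⟨rfl⟩

instance : IsTopologicalAddGroup (SmoothFunctions W) := (withSeminorms W).topologicalAddGroup

instance : ContinuousSMul ℂ (SmoothFunctions W) := (withSeminorms W).continuousSMul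

end SmoothFunctions

/-- The space `𝓔'(W)` of compactly supported distributions on an open set `W`: the dual of
`C^∞(W)`. As a space of continuous linear maps, it carries the strong dual topology of uniform
convergence on the bounded subsets of `C^∞(W)`. -/
abbrev CompactDistribution (W : Opens E) : Type _ := SmoothFunctions W →L[ℂ] ℂ

/-- A real-valued test function on `Ω`, restricted to `W` and regarded as an element of
`C^∞(W)`. -/
def testToSmooth {Ω : Opens E} (W : Opens E) (φ : 𝓓(Ω, ℝ)) : SmoothFunctions W :=
  SmoothFunctions.restrict W (fun x => (φ x : ℂ)) (Complex.ofRealCLM.contDiff.comp φ.contDiff)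

/-- `AgreeOn V g f`: the distributions `g ∈ 𝓔'(W)` and `f ∈ 𝓓'(Ω)` coincide on the open set
`V ⊆ W ∩ Ω`, that is, on all test functions supported in `V`. (By linearity it is enough to consider
real-valued test functions.) -/
def AgreeOn {Ω W : Opens E} (V : Opens E) (g : CompactDistribution W) (f : 𝓓'(Ω, ℂ)) : Prop :=
  V ≤ W ⊓ Ω ∧ ∀ φ : 𝓓(Ω, ℝ), tsupport φ ⊆ V → g (testToSmooth W φ) = f φ

/-- The open set `x₀ + U`. -/
def translateOpens (x₀ : E) (U : Opens E) : Opens E := ⟨x₀ +ᵥ (U : Set E), U.isOpen.vadd x₀⟩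

/-- `Γ` is an open conic neighbourhood of `ξ₀`. -/
def IsOpenConicNhd (Γ : Set E) (ξ₀ : E) : Prop :=
  IsOpen Γ ∧ ξ₀ ∈ Γ ∧ ∀ ξ ∈ Γ, ∀ t : ℝ, 0 < t → t • ξ ∈ Γ

end SmoothFunctions

section Euclidean

variable {d : ℕ}

theorem contDiff_wave (ξ : EuclideanSpace ℝ (Fin d)) :
    ContDiff ℝ ∞ fun x : EuclideanSpace ℝ (Fin d) =>
      Complex.exp (-2 * Real.pi * Complex.I * (inner ℝ x ξ : ℝ)) :=
  (contDiff_const.mul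
    (Complex.ofRealCLM.contDiff.comp (contDiff_id.inner ℝ contDiff_const))).cexp

/-- The Fourier transform `ĝ(ξ) = ⟨g(x), exp(-2π i x·ξ)⟩` of a compactly supported distribution. -/
def fourierCompact {W : Opens (EuclideanSpace ℝ (Fin d))} (g : CompactDistribution W)
    (ξ : EuclideanSpace ℝ (Fin d)) : ℂ :=
  g (SmoothFunctions.restrict W
    (fun x => Complex.exp (-2 * Real.pi * Complex.I * (inner ℝ x ξ : ℝ))) (contDiff_wave ξ))

/-- The distribution `f ∈ 𝓓'(Ω)` is analytically microlocally regular at `(x₀, ξ₀)`. -/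
def IsAnalyticMicroregularAt {Ω : Opens (EuclideanSpace ℝ (Fin d))} (f : 𝓓'(Ω, ℂ))
    (x₀ ξ₀ : EuclideanSpace ℝ (Fin d)) : Prop :=
  ∃ (Γ : Set (EuclideanSpace ℝ (Fin d))) (V : Opens (EuclideanSpace ℝ (Fin d)))
    (g : ℕ → CompactDistribution Ω),
    IsOpenConicNhd Γ ξ₀ ∧ x₀ ∈ V ∧ Bornology.IsVonNBounded ℂ (range g) ∧
    (∀ p, AgreeOn V (g p) f) ∧
    ∃ A > (0 : ℝ), ∃ C > (0 : ℝ), ∀ p : ℕ, ∀ ξ ∈ Γ,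
      ‖fourierCompact (g p) ξ‖ * ‖ξ‖ ^ p ≤ A * C ^ p * (p.factorial : ℝ)

/-- The analytic wave front set `WF_A(f) ⊆ Ω × (ℝ^d ∖ {0})` of a distribution `f ∈ 𝓓'(Ω)`. -/
def analyticWaveFrontSet {Ω : Opens (EuclideanSpace ℝ (Fin d))} (f : 𝓓'(Ω, ℂ)) :
    Set (EuclideanSpace ℝ (Fin d) × EuclideanSpace ℝ (Fin d)) :=
  {z | z.1 ∈ Ω ∧ z.2 ≠ 0 ∧ ¬ IsAnalyticMicroregularAt f z.1 z.2}

/-- The dual lattice `Λ* = {ν : μ·ν ∈ ℤ for all μ ∈ Λ}`. -/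
def dualLattice (Λ : Submodule ℤ (EuclideanSpace ℝ (Fin d))) :
    Set (EuclideanSpace ℝ (Fin d)) :=
  {ν | ∀ μ ∈ Λ, ∃ k : ℤ, inner ℝ μ ν = (k : ℝ)}

end Euclidean

end

/-! Both inclusions come from one localization principle, `exists_localized_sequence`. Suppose a
bounded sequence `g p` represents `f` near `x₀`, its Fourier transforms decay analytically at the
points of a lattice lying in a cone, and no nonzero dual lattice vector carries `x₀` into a compact
set `K` supporting the sequence. Then multiplication by suitable cutoffs `χ_p` near `x₀` gives a
bounded sequence with analytic decay at every point of a smaller cone.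

For the proof, periodize `χ_p(x) exp(-2πi x·ξ)` along the dual lattice. If the support of `χ_p` is
small, its nonzero translates miss a neighbourhood of `K`, so the periodization agrees with the
original function there. By Poisson summation it is a series of plane waves with lattice frequencies
`μ`, and applying `g p` termwise (`UniformlyBoundedBy.hasSum_wave`) expresses the transform of `χ_p
g p` at `ξ` through the values of that of `g p` at the `μ`. If `μ` is relatively close to `ξ`, it
lies in the given cone and the hypothesis applies. Otherwise `‖ξ - μ‖ ≥ c‖ξ‖`, and the coefficient
is small because the `p`-th cutoff obeys analytic bounds up to order `p`
(`exists_analytic_cutoffs_fourier`). The polynomial growth of the transform of `g p`, uniform by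
equicontinuity, is absorbed by a fixed number of further derivatives of the cutoff.

From continuous to lattice decay, the principle is used with an auxiliary lattice so fine that its
dual separates `K`; decay on a full cone then holds in particular on `Λ`. From lattice to continuous
decay, it is used with `Λ` itself, where `U ∩ Λ* = {0}` is exactly the separation condition. -/

noncomputable section

/-! ### Multiple series as products of one-dimensional series. -/

section ProductSums

theorem summable_norm_prod_and_tsum_prod {R κ : Type*} [NormedCommRing R] [CompleteSpace R] :
    ∀ {m : ℕ} (a : Fin m → κ → R), (∀ i, Summable fun k => ‖a i k‖) →
      (Summable fun n : Fin m → κ => ‖∏ i, a i (n i)‖) ∧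
        ∑' n : Fin m → κ, ∏ i, a i (n i) = ∏ i, ∑' k, a i k
  | 0, a, _ => by
      refine ⟨(hasSum_fintype _).summable, ?_⟩
      simp [tsum_fintype]
  | m + 1, a, ha => by
      obtain ⟨h1, h2⟩ := summable_norm_prod_and_tsum_prod (fun i => a (Fin.succ i))
        fun i => ha (Fin.succ i)
      have key : ∀ q : κ × (Fin m → κ),
          ∏ i, a i (Fin.consEquiv (fun _ : Fin (m + 1) => κ) q i)
            = a 0 q.1 * ∏ i, a (Fin.succ i) (q.2 i) := by
        intro q
        rw [Fin.prod_univ_succ]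
        simp [Fin.consEquiv]
      constructor
      · rw [← (Fin.consEquiv (fun _ : Fin (m + 1) => κ)).summable_iff]
        refine ((ha 0).mul_norm h1).congr fun q => ?_
        simp only [Function.comp_apply, key]
      · rw [← (Fin.consEquiv (fun _ : Fin (m + 1) => κ)).tsum_eq, Fin.prod_univ_succ, ← h2,
          tsum_mul_tsum_of_summable_norm (ha 0) h1]
        exact tsum_congr key

/-- Shifting the summation index by `⌊t⌋` reduces to `0 ≤ t < 1`, where the terms are dominated
independently of `t`. Uniformity matters because `t` will be a coordinate of the frequency `ξ`. -/
theorem summable_and_tsum_shifted_int_le :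
    ∃ D : ℝ, 0 < D ∧ ∀ t : ℝ, (Summable fun n : ℤ => ((1 + |t + n|) ^ 2)⁻¹) ∧
      ∑' n : ℤ, ((1 + |t + n|) ^ 2)⁻¹ ≤ D := by
  have h0 : Summable fun n : ℤ => 4 * ((1 + |(n : ℝ)|) ^ 2)⁻¹ := by
    refine Summable.mul_left _ ?_
    have h1 : Summable fun n : ℤ => |((n : ℝ) ^ 2)⁻¹| := by
      have := (Real.summable_one_div_int_pow (p := 2)).2 one_lt_two
      simpa using this.abs
    refine Summable.of_norm_bounded_eventually (g := fun n : ℤ => |((n : ℝ) ^ 2)⁻¹|) h1 ?_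
    rw [Filter.eventually_cofinite]
    refine (Set.finite_singleton (0 : ℤ)).subset fun n hn => ?_
    by_contra hn0
    apply hn
    have hn1 : (0 : ℝ) < |(n : ℝ)| := abs_pos.2 (by exact_mod_cast hn0)
    rw [Real.norm_of_nonneg (by positivity),
      abs_of_nonneg (a := ((n : ℝ) ^ 2)⁻¹) (by positivity), ← sq_abs (n : ℝ)]
    gcongr
    linarith
  have hle : ∀ t : ℝ, 0 ≤ t → t < 1 → ∀ n : ℤ,
      ((1 + |t + n|) ^ 2)⁻¹ ≤ 4 * ((1 + |(n : ℝ)|) ^ 2)⁻¹ := by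
    intro t ht0 ht1 n
    have h1 : 1 + |(n : ℝ)| ≤ 2 * (1 + |t + n|) := by
      have : |(n : ℝ)| ≤ |t + n| + |t| := by
        calc |(n : ℝ)| = |(t + n) - t| := by ring_nf
          _ ≤ _ := abs_sub _ _
      rw [abs_of_nonneg ht0] at this
      linarith [abs_nonneg (t + n)]
    have h2 : (1 + |(n : ℝ)|) ^ 2 ≤ 4 * (1 + |t + n|) ^ 2 := by
      calc (1 + |(n : ℝ)|) ^ 2 ≤ (2 * (1 + |t + n|)) ^ 2 := by gcongr
        _ = _ := by ring
    rw [← div_eq_mul_inv, le_div_iff₀ (by positivity), ← div_eq_inv_mul, div_le_iff₀ (by positivity)]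
    exact h2
  refine ⟨∑' n : ℤ, 4 * ((1 + |(n : ℝ)|) ^ 2)⁻¹ + 1, ?_, ?_⟩
  · have : 0 ≤ ∑' n : ℤ, 4 * ((1 + |(n : ℝ)|) ^ 2)⁻¹ := tsum_nonneg fun n => by positivity
    linarith
  · intro t
    have hs : ∀ n : ℤ, ((1 + |t + n|) ^ 2)⁻¹
        = ((1 + |Int.fract t + ((Equiv.addRight ⌊t⌋ n : ℤ) : ℝ)|) ^ 2)⁻¹ := by
      intro n
      have : Int.fract t + ((Equiv.addRight ⌊t⌋ n : ℤ) : ℝ) = t + n := by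
        rw [Equiv.coe_addRight, Int.cast_add, ← Int.self_sub_floor]; ring
      rw [this]
    have hb := hle (Int.fract t) (Int.fract_nonneg t) (Int.fract_lt_one t)
    have hsum : Summable fun n : ℤ => ((1 + |Int.fract t + n|) ^ 2)⁻¹ :=
      Summable.of_nonneg_of_le (fun n => by positivity) hb h0
    constructor
    · refine ((Equiv.addRight ⌊t⌋).summable_iff.2 hsum).congr fun n => ?_
      exact (hs n).symm
    · rw [tsum_congr hs,
        (Equiv.addRight ⌊t⌋).tsum_eq fun n : ℤ => ((1 + |Int.fract t + n|) ^ 2)⁻¹]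
      have := hsum.tsum_le_tsum hb h0
      linarith

/-- The sums `∑ₙ ∏ᵢ (1 + |tᵢ + nᵢ|)⁻²` over `ℤ^m` are bounded uniformly in `t`. -/
theorem exists_tsum_prod_shifted_int_le (m : ℕ) :
    ∃ D : ℝ, 0 < D ∧ ∀ t : Fin m → ℝ,
      (Summable fun n : Fin m → ℤ => ∏ i, ((1 + |t i + n i|) ^ 2)⁻¹) ∧
      ∑' n : Fin m → ℤ, ∏ i, ((1 + |t i + n i|) ^ 2)⁻¹ ≤ D := by
  obtain ⟨D, hD, h⟩ := summable_and_tsum_shifted_int_le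
  refine ⟨D ^ m, by positivity, fun t => ?_⟩
  obtain ⟨h1, h2⟩ := summable_norm_prod_and_tsum_prod
    (fun i (n : ℤ) => ((1 + |t i + n|) ^ 2)⁻¹) fun i => (h (t i)).1.norm
  refine ⟨h1.of_norm, ?_⟩
  rw [h2]
  calc ∏ i, ∑' n : ℤ, ((1 + |t i + n|) ^ 2)⁻¹ ≤ ∏ _i : Fin m, D :=
        Finset.prod_le_prod (fun i _ => tsum_nonneg fun n => by positivity) fun i _ => (h (t i)).2
    _ = D ^ m := by simp

end ProductSums

/-! ### Cutoffs with analytic derivative bounds up to order `N`, by repeated averaging. -/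

section Cutoffs

/-- The average of `u` over the interval of radius `ε` around `x`. -/
def intervalAverage (ε : ℝ) (u : ℝ → ℂ) (x : ℝ) : ℂ :=
  ((2 * ε)⁻¹ : ℝ) • ∫ t in (x - ε)..(x + ε), u t

variable {ε : ℝ} {u : ℝ → ℂ}

theorem hasDerivAt_intervalAverage (hu : Continuous u) (x : ℝ) :
    HasDerivAt (intervalAverage ε u) (((2 * ε)⁻¹ : ℝ) • (u (x + ε) - u (x - ε))) x := by
  have hF : ∀ y, HasDerivAt (fun z => ∫ t in (0 : ℝ)..z, u t) (u y) y := fun y =>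
    intervalIntegral.integral_hasDerivAt_right (hu.intervalIntegrable _ _)
      (hu.stronglyMeasurableAtFilter _ _) hu.continuousAt
  have h1 := (hF (x + ε)).comp_add_const x ε
  have h2 := (hF (x - ε)).comp_sub_const x ε
  refine ((h1.sub h2).const_smul ((2 * ε)⁻¹ : ℝ)).congr_of_eventuallyEq (.of_forall fun y => ?_)
  simp only [intervalAverage, Pi.smul_apply, Pi.sub_apply]
  rw [intervalIntegral.integral_interval_sub_left (hu.intervalIntegrable _ _)
    (hu.intervalIntegrable _ _)]

theorem deriv_intervalAverage (hu : ContDiff ℝ 1 u) :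
    deriv (intervalAverage ε u) = intervalAverage ε (deriv u) := by
  funext x
  rw [(hasDerivAt_intervalAverage hu.continuous x).deriv, intervalAverage,
    intervalIntegral.integral_deriv_eq_sub
      (fun y _ => (hu.differentiable one_ne_zero) y)
      ((hu.continuous_deriv le_rfl).intervalIntegrable _ _)]

theorem contDiff_intervalAverage (hu : ContDiff ℝ ∞ u) : ContDiff ℝ ∞ (intervalAverage ε u) := by
  rw [contDiff_infty]
  intro n
  induction n generalizing u with
  | zero =>
    exact contDiff_zero.2 (continuous_iff_continuousAt.2 fun x =>
      (hasDerivAt_intervalAverage hu.continuous x).continuousAt)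
  | succ n ih =>
    push_cast
    rw [contDiff_succ_iff_deriv]
    refine ⟨fun x => (hasDerivAt_intervalAverage hu.continuous x).differentiableAt,
      fun h => absurd h (by simp), ?_⟩
    rw [deriv_intervalAverage (hu.of_le (by exact_mod_cast le_top))]
    exact ih (contDiff_infty_iff_deriv.1 hu).2

theorem iteratedDeriv_intervalAverage (hu : ContDiff ℝ ∞ u) (j : ℕ) :
    iteratedDeriv j (intervalAverage ε u) = intervalAverage ε (iteratedDeriv j u) := by
  induction j generalizing u with
  | zero => simp
  | succ j ih =>
    rw [iteratedDeriv_succ', deriv_intervalAverage (hu.of_le (by exact_mod_cast le_top)),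
      ih (contDiff_infty_iff_deriv.1 hu).2, ← iteratedDeriv_succ']

theorem norm_intervalAverage_le (hε : 0 < ε) {B : ℝ} (hB : ∀ x, ‖u x‖ ≤ B) (x : ℝ) :
    ‖intervalAverage ε u x‖ ≤ B := by
  rw [intervalAverage, norm_smul, Real.norm_of_nonneg (by positivity)]
  have h := intervalIntegral.norm_integral_le_of_norm_le_const (a := x - ε) (b := x + ε) (C := B)
    (f := u) fun y _ => hB y
  have h2 : |x + ε - (x - ε)| = 2 * ε := by
    rw [show x + ε - (x - ε) = 2 * ε by ring, abs_of_pos (by positivity)]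
  rw [h2] at h
  calc (2 * ε)⁻¹ * _ ≤ (2 * ε)⁻¹ * (B * (2 * ε)) := by gcongr
    _ = B := by field_simp

theorem intervalAverage_eq_const (hε : 0 < ε) {c : ℂ} {x : ℝ}
    (h : ∀ t, |t - x| ≤ ε → u t = c) : intervalAverage ε u x = c := by
  have h1 : ∫ t in (x - ε)..(x + ε), u t = ∫ _t in (x - ε)..(x + ε), c := by
    refine intervalIntegral.integral_congr fun t ht => h t ?_
    rw [uIcc_of_le (by linarith), mem_Icc] at ht
    exact abs_le.2 ⟨by linarith, by linarith⟩
  rw [intervalAverage, h1, intervalIntegral.integral_const, smul_smul,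
    show x + ε - (x - ε) = 2 * ε by ring, inv_mul_cancel₀ (by positivity), one_smul]

/-- The derivative of an average is a difference quotient over length `2ε`, so each averaging pays
for one derivative with a factor `ε⁻¹`. It moves the edges of the support and of the plateau by at
most `ε`, and it commutes with the remaining `j` derivatives. -/
theorem iterate_intervalAverage_spec (hε : 0 < ε) (hu : ContDiff ℝ ∞ u) {B : ℕ → ℝ}
    (hB : ∀ j x, ‖iteratedDeriv j u x‖ ≤ B j) {a b : ℝ} (ha : ∀ x, a ≤ |x| → u x = 0)
    (hb : ∀ x, |x| ≤ b → u x = 1) (m : ℕ) :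
    ContDiff ℝ ∞ ((intervalAverage ε)^[m] u) ∧
    (∀ x, a + m * ε ≤ |x| → (intervalAverage ε)^[m] u x = 0) ∧
    (∀ x, |x| ≤ b - m * ε → (intervalAverage ε)^[m] u x = 1) ∧
    ∀ i ≤ m, ∀ j x, ‖iteratedDeriv (j + i) ((intervalAverage ε)^[m] u) x‖ ≤ B j * (ε⁻¹) ^ i := by
  induction m with
  | zero =>
    refine ⟨hu, by simpa using ha, by simpa using hb, fun i hi j x => ?_⟩
    obtain rfl : i = 0 := by omega
    simpa using hB j x
  | succ m ih =>
    obtain ⟨h1, h2, h3, h4⟩ := ih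
    rw [Function.iterate_succ_apply']
    set v := (intervalAverage ε)^[m] u
    refine ⟨contDiff_intervalAverage h1, fun x hx => ?_, fun x hx => ?_, fun i hi j x => ?_⟩
    · refine intervalAverage_eq_const hε fun t ht => h2 t ?_
      have : |x| ≤ |t| + |t - x| := by
        rw [abs_sub_comm]
        calc |x| = |t + (x - t)| := by ring_nf
          _ ≤ _ := abs_add_le _ _
      push_cast at hx
      linarith
    · refine intervalAverage_eq_const hε fun t ht => h3 t ?_
      have : |t| ≤ |x| + |t - x| := by
        calc |t| = |x + (t - x)| := by ring_nf
          _ ≤ _ := abs_add_le _ _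
      push_cast at hx
      linarith
    · rcases i with _ | i
      · simp only [add_zero, pow_zero, mul_one]
        rw [iteratedDeriv_intervalAverage h1]
        exact norm_intervalAverage_le hε (fun y => by simpa using h4 0 (Nat.zero_le _) j y) x
      · rw [← add_assoc, iteratedDeriv_succ, iteratedDeriv_intervalAverage h1,
          (hasDerivAt_intervalAverage (h1.continuous_iteratedDeriv _
            (by exact_mod_cast le_top)) x).deriv, norm_smul, Real.norm_of_nonneg (by positivity)]
        have h5 := h4 i (by omega) j
        calc (2 * ε)⁻¹ * _ ≤ (2 * ε)⁻¹ * (B j * ε⁻¹ ^ i + B j * ε⁻¹ ^ i) := by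
              gcongr
              exact (norm_sub_le _ _).trans (add_le_add (h5 _) (h5 _))
          _ = B j * ε⁻¹ ^ (i + 1) := by
              rw [pow_succ, mul_inv]; ring

/-- A single term of the exponential series at `N + 1` is at most its sum. This converts the `N`-th
power of an inverse width of size `N + 1` into a factorial. -/
theorem pow_self_succ_le_exp_mul_factorial (N : ℕ) :
    ((N : ℝ) + 1) ^ N ≤ Real.exp 1 * Real.exp 1 ^ N * (N.factorial : ℝ) := by
  have h := Real.pow_div_factorial_le_exp (x := (N : ℝ) + 1) (by positivity) (N + 1)
  rw [div_le_iff₀ (by positivity), Nat.factorial_succ, pow_succ] at h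
  have h2 : Real.exp ((N : ℝ) + 1) = Real.exp 1 * Real.exp 1 ^ N := by
    rw [← Real.exp_nat_mul, mul_one, ← Real.exp_add, add_comm]
  rw [h2] at h
  push_cast at h
  have h3 : (0 : ℝ) < (N : ℝ) + 1 := by positivity
  refine le_of_mul_le_mul_right ?_ h3
  linarith

/-- Cutoff functions on the real line whose derivatives of order up to `N` grow at the analytic
rate. -/
theorem exists_analytic_cutoffs {δ : ℝ} (hδ : 0 < δ) :
    ∃ r > 0, ∃ θ : ℕ → ℝ → ℂ, (∀ N, ContDiff ℝ ∞ (θ N)) ∧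
      (∀ N x, δ ≤ |x| → θ N x = 0) ∧ (∀ N x, |x| ≤ r → θ N x = 1) ∧
      (∀ j, ∃ B, ∀ N x, ‖iteratedDeriv j (θ N) x‖ ≤ B) ∧
      ∃ C > 0, ∀ j, ∃ B, ∀ N x,
        ‖iteratedDeriv (j + N) (θ N) x‖ ≤ B * C ^ N * (N.factorial : ℝ) := by
  let w : ContDiffBump (0 : ℝ) := ⟨δ / 2, 3 * δ / 4, by positivity, by linarith⟩
  let u : ℝ → ℂ := fun x => (w x : ℂ)
  have hu : ContDiff ℝ ∞ u := Complex.ofRealCLM.contDiff.comp w.contDiff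
  have hus : HasCompactSupport u := w.hasCompactSupport.comp_left (g := Complex.ofReal) (by simp)
  have hB : ∀ j, ∃ B, ∀ x, ‖iteratedDeriv j u x‖ ≤ B := fun j => by
    refine Continuous.bounded_above_of_compact_support
      (hu.continuous_iteratedDeriv _ (by exact_mod_cast le_top)) ?_
    have := hus.iteratedFDeriv (𝕜 := ℝ) j
    simp only [iteratedDeriv_eq_equiv_comp]
    exact this.comp_left (by simp)
  choose B hB using hB
  -- With this width, `N` averagings move the edges by at most `δ / 4` in total: the support stays
  -- within radius `3δ/4 + δ/4 = δ` and the plateau keeps radius `δ/2 - δ/4 = δ/4`.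
  have hεN : ∀ N : ℕ, (0 : ℝ) < δ / (4 * (N + 1)) := fun N => by positivity
  have hNε : ∀ N : ℕ, (N : ℝ) * (δ / (4 * (N + 1))) ≤ δ / 4 := fun N => by
    rw [← mul_div_assoc, div_le_div_iff₀ (by positivity) (by positivity)]
    nlinarith
  have hspec := fun N : ℕ => iterate_intervalAverage_spec (hεN N) hu hB (a := 3 * δ / 4) (b := δ / 2)
    (fun x hx => by
      have : w x = 0 := w.zero_of_le_dist (by simpa using hx)
      simp [u, this])
    (fun x hx => by
      have : w x = 1 := w.one_of_mem_closedBall (by simpa using hx)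
      simp [u, this]) N
  refine ⟨δ / 4, by positivity, fun N => (intervalAverage (δ / (4 * (N + 1))))^[N] u,
    fun N => (hspec N).1, fun N x hx => (hspec N).2.1 x (by linarith [hNε N]),
    fun N x hx => (hspec N).2.2.1 x (by linarith [hNε N]),
    fun j => ⟨B j, fun N x => by simpa using (hspec N).2.2.2 0 (Nat.zero_le _) j x⟩,
    4 / δ * Real.exp 1, by positivity, fun j => ⟨B j * Real.exp 1, fun N x => ?_⟩⟩
  have hB0 : 0 ≤ B j := (norm_nonneg _).trans (hB j 0)
  refine ((hspec N).2.2.2 N le_rfl j x).trans ?_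
  have h1 : (δ / (4 * ((N : ℝ) + 1)))⁻¹ ^ N = (4 / δ) ^ N * ((N : ℝ) + 1) ^ N := by
    rw [← mul_pow]; congr 1; field_simp
  rw [h1]
  calc B j * ((4 / δ) ^ N * ((N : ℝ) + 1) ^ N)
      ≤ B j * ((4 / δ) ^ N * (Real.exp 1 * Real.exp 1 ^ N * (N.factorial : ℝ))) := by
        gcongr; exact pow_self_succ_le_exp_mul_factorial N
    _ = _ := by rw [mul_pow]; ring

end Cutoffs

/-! ### Fourier decay of the cutoffs and Poisson summation. -/

section FourierSide

open scoped FourierTransform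
open MeasureTheory

variable {θ : ℝ → ℂ} {δ : ℝ}

theorem hasCompactSupport_of_zero_of_le_abs (hθ0 : ∀ x, δ ≤ |x| → θ x = 0) :
    HasCompactSupport θ := by
  refine HasCompactSupport.intro (isCompact_closedBall (0 : ℝ) δ) fun x hx => hθ0 x ?_
  rw [Metric.mem_closedBall, dist_zero_right, Real.norm_eq_abs, not_le] at hx
  exact hx.le

/-- The transform of the `n`-th derivative is `(2πit)^n 𝓕 θ t`, and it is bounded by the integral
over `[-δ, δ]`. The factor `(2π)^n ≥ 1` is discarded. -/
theorem abs_pow_mul_norm_fourier_le (hδ : 0 < δ) (hθ : ContDiff ℝ ∞ θ)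
    (hθ0 : ∀ x, δ ≤ |x| → θ x = 0) {n : ℕ} {B : ℝ} (hB : ∀ x, ‖iteratedDeriv n θ x‖ ≤ B) (t : ℝ) :
    |t| ^ n * ‖𝓕 θ t‖ ≤ 2 * δ * B := by
  have hcs : ∀ j, HasCompactSupport (iteratedDeriv j θ) := fun j => by
    have := (hasCompactSupport_of_zero_of_le_abs hθ0).iteratedFDeriv (𝕜 := ℝ) j
    simp only [iteratedDeriv_eq_equiv_comp]
    exact this.comp_left (by simp)
  have hcont : ∀ j, Continuous (iteratedDeriv j θ) := fun j =>
    hθ.continuous_iteratedDeriv _ (by exact_mod_cast le_top)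
  have h1 := congrFun (Real.fourier_iteratedDeriv (N := ⊤) (n := n) hθ
    (fun j _ => (hcont j).integrable_of_hasCompactSupport (hcs j)) le_top) t
  have h2 : ‖𝓕 (iteratedDeriv n θ) t‖ ≤ ∫ x, ‖iteratedDeriv n θ x‖ :=
    VectorFourier.norm_fourierIntegral_le_integral_norm _ _ _ _ _
  have hzero : ∀ x, x ∉ Icc (-δ) δ → ‖iteratedDeriv n θ x‖ = 0 := by
    intro x hx
    have hx' : δ < |x| := by
      by_contra hc
      exact hx (abs_le.1 (not_lt.1 hc))
    have : θ =ᶠ[nhds x] fun _ => 0 := by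
      filter_upwards [(isOpen_lt continuous_const continuous_abs).mem_nhds hx'] with z hz
      exact hθ0 z (le_of_lt hz)
    rw [(this.iteratedDeriv_eq n)]
    simp
  have h3 : ∫ x, ‖iteratedDeriv n θ x‖ ≤ 2 * δ * B := by
    rw [← setIntegral_eq_integral_of_forall_compl_eq_zero hzero]
    have := norm_setIntegral_le_of_norm_le_const (μ := volume) (s := Icc (-δ) δ)
      (f := fun x => ‖iteratedDeriv n θ x‖) (C := B) (by simp) fun x _ => by simpa using hB x
    refine (le_abs_self _).trans (this.trans (le_of_eq ?_))
    rw [Real.volume_real_Icc_of_le (by linarith)]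
    ring
  have h4 : ‖𝓕 (iteratedDeriv n θ) t‖ = (2 * Real.pi * |t|) ^ n * ‖𝓕 θ t‖ := by
    rw [h1, norm_smul, norm_pow]
    simp [abs_of_pos Real.pi_pos]
  have h5 : |t| ^ n ≤ (2 * Real.pi * |t|) ^ n := by
    gcongr
    nlinarith [Real.pi_gt_three, abs_nonneg t]
  calc |t| ^ n * ‖𝓕 θ t‖ ≤ (2 * Real.pi * |t|) ^ n * ‖𝓕 θ t‖ := by gcongr
    _ ≤ 2 * δ * B := by rw [← h4]; exact h2.trans h3

theorem one_add_pow_le {x : ℝ} (hx : 0 ≤ x) (k : ℕ) : (1 + x) ^ k ≤ 2 ^ k * (1 + x ^ k) := by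
  rcases le_total x 1 with h | h
  · calc (1 + x) ^ k ≤ 2 ^ k := by gcongr; linarith
      _ ≤ 2 ^ k * (1 + x ^ k) := le_mul_of_one_le_right (by positivity)
        (by linarith [pow_nonneg hx k])
  · calc (1 + x) ^ k ≤ (2 * x) ^ k := by gcongr; linarith
      _ = 2 ^ k * x ^ k := mul_pow _ _ _
      _ ≤ 2 ^ k * (1 + x ^ k) := by gcongr; linarith

/-- Cutoff functions on the real line together with the decay of their Fourier transforms. -/
theorem exists_analytic_cutoffs_fourier (hδ : 0 < δ) :
    ∃ r > 0, ∃ θ : ℕ → ℝ → ℂ, (∀ N, ContDiff ℝ ∞ (θ N)) ∧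
      (∀ N x, δ ≤ |x| → θ N x = 0) ∧ (∀ N x, |x| ≤ r → θ N x = 1) ∧
      (∀ j, ∃ B, ∀ N x, ‖iteratedDeriv j (θ N) x‖ ≤ B) ∧
      ∃ C > 0, ∀ k, ∃ B > 0, ∀ N t, (1 + |t|) ^ k * ‖𝓕 (θ N) t‖ ≤ B ∧
        (1 + |t|) ^ k * (|t| ^ N * ‖𝓕 (θ N) t‖) ≤ B * C ^ N * (N.factorial : ℝ) := by
  obtain ⟨r, hr, θ, h1, h2, h3, h4, C, hC, h5⟩ := exists_analytic_cutoffs hδ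
  refine ⟨r, hr, θ, h1, h2, h3, h4, C, hC, fun k => ?_⟩
  obtain ⟨B0, hB0⟩ := h4 0
  obtain ⟨Bk, hBk⟩ := h4 k
  obtain ⟨D0, hD0⟩ := h5 0
  obtain ⟨Dk, hDk⟩ := h5 k
  refine ⟨2 ^ k * (2 * δ * (|B0| + |Bk| + |D0| + |Dk| + 1)), by positivity, fun N t => ⟨?_, ?_⟩⟩
  · have e0 := abs_pow_mul_norm_fourier_le hδ (h1 N) (h2 N) (hB0 N) t
    have ek := abs_pow_mul_norm_fourier_le hδ (h1 N) (h2 N) (hBk N) t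
    calc (1 + |t|) ^ k * ‖𝓕 (θ N) t‖ ≤ (2 ^ k * (1 + |t| ^ k)) * ‖𝓕 (θ N) t‖ := by
          gcongr; exact one_add_pow_le (abs_nonneg t) k
      _ = 2 ^ k * (|t| ^ 0 * ‖𝓕 (θ N) t‖ + |t| ^ k * ‖𝓕 (θ N) t‖) := by ring
      _ ≤ 2 ^ k * (2 * δ * B0 + 2 * δ * Bk) := by gcongr
      _ ≤ _ := by
        rw [← mul_add]
        have : B0 + Bk ≤ |B0| + |Bk| + |D0| + |Dk| + 1 := by
          linarith [le_abs_self B0, le_abs_self Bk, abs_nonneg D0, abs_nonneg Dk]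
        generalize |B0| + |Bk| + |D0| + |Dk| + 1 = S at *
        gcongr
  · have e0 := abs_pow_mul_norm_fourier_le hδ (h1 N) (h2 N) (hD0 N) t
    have ek := abs_pow_mul_norm_fourier_le hδ (h1 N) (h2 N) (hDk N) t
    calc (1 + |t|) ^ k * (|t| ^ N * ‖𝓕 (θ N) t‖)
        ≤ (2 ^ k * (1 + |t| ^ k)) * (|t| ^ N * ‖𝓕 (θ N) t‖) := by
          gcongr; exact one_add_pow_le (abs_nonneg t) k
      _ = 2 ^ k * (|t| ^ (0 + N) * ‖𝓕 (θ N) t‖ + |t| ^ (k + N) * ‖𝓕 (θ N) t‖) := by ring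
      _ ≤ 2 ^ k * (2 * δ * (D0 * C ^ N * (N.factorial : ℝ))
            + 2 * δ * (Dk * C ^ N * (N.factorial : ℝ))) := by gcongr
      _ = 2 ^ k * (2 * δ * (D0 + Dk)) * C ^ N * (N.factorial : ℝ) := by ring
      _ ≤ _ := by
        have : D0 + Dk ≤ |B0| + |Bk| + |D0| + |Dk| + 1 := by
          linarith [le_abs_self D0, le_abs_self Dk, abs_nonneg B0, abs_nonneg Bk]
        generalize |B0| + |Bk| + |D0| + |Dk| + 1 = S at *
        gcongr

/-- Poisson summation for the modulated function `x ↦ θ(x) exp(-2πitx)`, whose transform at `n` is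
`𝓕 θ (t + n)`. -/
theorem tsum_modulated_eq_tsum_fourier (hθ : ContDiff ℝ ∞ θ)
    (hθ0 : ∀ x, δ ≤ |x| → θ x = 0) (t s : ℝ) :
    ∑' k : ℤ, θ (s + k) * Complex.exp (-2 * Real.pi * Complex.I * (t * (s + k) : ℝ))
      = ∑' n : ℤ, 𝓕 θ (t + n) * Complex.exp (2 * Real.pi * Complex.I * (n * s : ℝ)) := by
  have hsm : ContDiff ℝ ∞ fun x : ℝ =>
      θ x * Complex.exp (-2 * Real.pi * Complex.I * (t * x : ℝ)) :=
    hθ.mul (contDiff_const.mul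
      (Complex.ofRealCLM.contDiff.comp (contDiff_const.mul contDiff_id))).cexp
  have hcs : HasCompactSupport fun x : ℝ =>
      θ x * Complex.exp (-2 * Real.pi * Complex.I * (t * x : ℝ)) :=
    (hasCompactSupport_of_zero_of_le_abs hθ0).mul_right
  have h := SchwartzMap.tsum_eq_tsum_fourier (hcs.toSchwartzMap hsm) s
  refine h.trans (tsum_congr fun n => ?_)
  congr 1
  · change 𝓕 (fun x : ℝ => θ x * Complex.exp (-2 * Real.pi * Complex.I * (t * x : ℝ))) (n : ℝ) = _
    rw [Real.fourier_real_eq_integral_exp_smul, Real.fourier_real_eq_integral_exp_smul]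
    congr 1 with x
    rw [smul_eq_mul, smul_eq_mul, mul_left_comm, ← Complex.exp_add, mul_comm]
    congr 2
    push_cast
    ring
  · rw [fourier_coe_apply]
    congr 1
    push_cast
    ring

theorem norm_exp_two_pi_I (x : ℝ) : ‖Complex.exp (2 * Real.pi * Complex.I * (x : ℝ))‖ = 1 := by
  rw [show 2 * (Real.pi : ℂ) * Complex.I * (x : ℝ) = ((2 * Real.pi * x : ℝ) : ℂ) * Complex.I by
    push_cast; ring]
  exact Complex.norm_exp_ofReal_mul_I _

/-- The left side is a product of one-dimensional periodizations. If some integer translate of `y`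
lies in the box of radius `δ`, `hy` makes it the trivial one, and `δ ≤ 1 / 2` kills all other terms
in each coordinate. If none does, then, the coordinates being independent, one coordinate has no
translate in the interval, and both sides vanish. -/
theorem tsum_prod_fourier_eq (hδ : δ ≤ 1 / 2) (hθ : ContDiff ℝ ∞ θ)
    (hθ0 : ∀ x, δ ≤ |x| → θ x = 0) {B : ℝ} (hdec : ∀ t, (1 + |t|) ^ 2 * ‖𝓕 θ t‖ ≤ B) {m : ℕ}
    (ζ y : Fin m → ℝ) (hy : ∀ k : Fin m → ℤ, (∀ i, |y i + k i| < δ) → k = 0) :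
    ∑' n : Fin m → ℤ, ∏ i, (𝓕 θ (ζ i + n i) *
        Complex.exp (2 * Real.pi * Complex.I * (n i * y i : ℝ)))
      = ∏ i, (θ (y i) * Complex.exp (-2 * Real.pi * Complex.I * (ζ i * y i : ℝ))) := by
  obtain ⟨D, _, hD⟩ := summable_and_tsum_shifted_int_le
  have hsum : ∀ i, Summable fun n : ℤ => ‖𝓕 θ (ζ i + n) *
      Complex.exp (2 * Real.pi * Complex.I * (n * y i : ℝ))‖ := fun i => by
    refine Summable.of_nonneg_of_le (fun n => norm_nonneg _) (fun n => ?_)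
      ((hD (ζ i)).1.mul_left B)
    rw [norm_mul, norm_exp_two_pi_I, mul_one, ← div_eq_mul_inv, le_div_iff₀ (by positivity),
      mul_comm]
    exact hdec _
  rw [(summable_norm_prod_and_tsum_prod (fun i (n : ℤ) => 𝓕 θ (ζ i + n) *
      Complex.exp (2 * Real.pi * Complex.I * (n * y i : ℝ))) hsum).2]
  simp only [← tsum_modulated_eq_tsum_fourier hθ hθ0]
  by_cases hk : ∃ k : Fin m → ℤ, ∀ i, |y i + k i| < δ
  · obtain ⟨k, hk⟩ := hk
    obtain rfl := hy k hk
    refine Finset.prod_congr rfl fun i _ => ?_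
    rw [tsum_eq_single 0]
    · simp
    · intro n hn
      have h1 : |y i| < δ := by simpa using hk i
      have h2 : (1 : ℝ) ≤ |(n : ℝ)| := by exact_mod_cast Int.one_le_abs hn
      have h3 : |(n : ℝ)| ≤ |y i + n| + |y i| := by
        calc |(n : ℝ)| = |(y i + n) - y i| := by ring_nf
          _ ≤ _ := abs_sub _ _
      rw [hθ0 _ (by linarith), zero_mul]
  · have h1 : ∃ i, ∀ n : ℤ, δ ≤ |y i + n| := by
      by_contra hc
      push Not at hc
      choose k hk' using hc
      exact hk ⟨k, hk'⟩
    obtain ⟨i, hi⟩ := h1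
    rw [Finset.prod_eq_zero (Finset.mem_univ i), Finset.prod_eq_zero (Finset.mem_univ i)]
    · rw [hθ0 _ (by simpa using hi 0), zero_mul]
    · simp [hθ0 _ (hi _)]

end FourierSide

/-! ### Bounded families of compactly supported distributions and their cutoffs. -/

section CompactDistributions

variable {E : Type*} [NormedAddCommGroup E] [NormedSpace ℝ E]

theorem SmoothFunctions.iteratedFDeriv_restrict {W : Opens E} {g : E → ℂ} (hg : ContDiff ℝ ∞ g)
    {x : E} (hx : x ∈ W) (n : ℕ) :
    iteratedFDeriv ℝ n (SmoothFunctions.restrict W g hg) x = iteratedFDeriv ℝ n g x := by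
  refine Filter.EventuallyEq.eq_of_nhds (Filter.EventuallyEq.iteratedFDeriv ℝ ?_ n)
  filter_upwards [W.isOpen.mem_nhds hx] with z hz
  exact indicator_of_mem hz g

theorem SmoothFunctions.iteratedFDeriv_smul {W : Opens E} (c : ℂ) (φ : SmoothFunctions W)
    {x : E} (hx : x ∈ W) (n : ℕ) :
    iteratedFDeriv ℝ n (c • φ : SmoothFunctions W) x = c • iteratedFDeriv ℝ n φ x :=
  iteratedFDeriv_const_smul_apply ((φ.contDiffAt hx).of_le (by exact_mod_cast le_top))

theorem SmoothFunctions.ext {W : Opens E} {φ ψ : SmoothFunctions W} (h : ∀ x, φ x = ψ x) : φ = ψ :=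
  Subtype.ext (funext h)

/-- The linear functionals `g p` on `C^∞(W)` satisfy a common estimate by the derivatives of order
at most `M` on the compact set `K ⊆ W`. -/
def UniformlyBoundedBy {W : Opens E} {κ : Type*} (g : κ → SmoothFunctions W →ₗ[ℂ] ℂ)
    (K : Compacts E) (M : ℕ) (C : ℝ) : Prop :=
  (K : Set E) ⊆ W ∧ ∀ (p : κ) (φ : SmoothFunctions W) (S : ℝ), 0 ≤ S →
    (∀ j ≤ M, ∀ x ∈ K, ‖iteratedFDeriv ℝ j φ x‖ ≤ S) → ‖g p φ‖ ≤ C * S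

theorem SmoothFunctions.norm_le_seminorm {W : Opens E} {K : Compacts E} (hK : (K : Set E) ⊆ W)
    (n : ℕ) (φ : SmoothFunctions W) {x : E} (hx : x ∈ K) :
    ‖iteratedFDeriv ℝ n φ x‖ ≤ SmoothFunctions.seminormFamily W (⟨K, hK⟩, n) φ :=
  le_ciSup (φ.bddAbove_range_norm ⟨K, hK⟩ n) (⟨x, hx⟩ : (K : Set E))

theorem SmoothFunctions.seminorm_le {W : Opens E} {K : Compacts E} (hK : (K : Set E) ⊆ W)
    (n : ℕ) (φ : SmoothFunctions W) {S : ℝ} (hS : 0 ≤ S)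
    (h : ∀ x ∈ K, ‖iteratedFDeriv ℝ n φ x‖ ≤ S) :
    SmoothFunctions.seminormFamily W (⟨K, hK⟩, n) φ ≤ S :=
  Real.iSup_le (fun x => h x x.2) hS

theorem UniformlyBoundedBy.norm_le_sup {W : Opens E} {κ : Type*}
    {g : κ → SmoothFunctions W →ₗ[ℂ] ℂ} {K : Compacts E} {M : ℕ} {C : ℝ}
    (h : UniformlyBoundedBy g K M C) (p : κ) (φ : SmoothFunctions W) :
    ‖g p φ‖ ≤ C * ∑ j ∈ Finset.range (M + 1),
      SmoothFunctions.seminormFamily W (⟨K, h.1⟩, j) φ := by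
  refine h.2 p φ _ (Finset.sum_nonneg fun j _ => apply_nonneg _ _) fun j hj x hx => ?_
  refine (SmoothFunctions.norm_le_seminorm h.1 j φ hx).trans ?_
  exact Finset.single_le_sum
    (f := fun j => SmoothFunctions.seminormFamily W (⟨K, h.1⟩, j) φ)
    (fun i _ => apply_nonneg _ _) (Finset.mem_range.2 (by omega))

theorem UniformlyBoundedBy.continuous {W : Opens E} {κ : Type*}
    {g : κ → SmoothFunctions W →ₗ[ℂ] ℂ} {K : Compacts E} {M : ℕ} {C : ℝ}
    (h : UniformlyBoundedBy g K M C) (p : κ) : Continuous (g p) := by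
  have hs : Continuous fun φ : SmoothFunctions W => C * ∑ j ∈ Finset.range (M + 1),
      SmoothFunctions.seminormFamily W (⟨K, h.1⟩, j) φ :=
    continuous_const.mul (continuous_finsetSum _ fun j _ =>
      (SmoothFunctions.withSeminorms W).continuous_seminorm _)
  refine continuous_of_continuousAt_zero (g p) ?_
  rw [ContinuousAt, map_zero]
  refine squeeze_zero_norm (h.norm_le_sup p) ?_
  simpa using hs.tendsto 0

theorem UniformlyBoundedBy.isVonNBounded {W : Opens E} {κ : Type*}
    {g : κ → CompactDistribution W} {K : Compacts E} {M : ℕ} {C : ℝ}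
    (h : UniformlyBoundedBy (fun p => (g p : SmoothFunctions W →ₗ[ℂ] ℂ)) K M C) :
    Bornology.IsVonNBounded ℂ (range g) := by
  rw [ContinuousLinearMap.isVonNBounded_iff]
  intro s hs
  rw [(SmoothFunctions.withSeminorms W).isVonNBounded_iff_seminorm_bounded] at hs
  choose r hr0 hr using hs
  rw [NormedSpace.isVonNBounded_iff']
  refine ⟨|C| * ∑ j ∈ Finset.range (M + 1), r (⟨K, h.1⟩, j), ?_⟩
  rintro _ ⟨_, ⟨p, rfl⟩, φ, hφ, rfl⟩
  refine (h.norm_le_sup p φ).trans ?_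
  refine (mul_le_mul_of_nonneg_right (le_abs_self C)
    (Finset.sum_nonneg fun j _ => apply_nonneg _ _)).trans ?_
  gcongr with j _
  exact (hr _ φ hφ).le

theorem exists_compacts_exhaustion [FiniteDimensional ℝ E] (W : Opens E) :
    ∃ K : ℕ → Compacts E, (∀ n, (K n : Set E) ⊆ W) ∧ Monotone K ∧
      ∀ L : Compacts E, (L : Set E) ⊆ W → ∃ n, L ≤ K n := by
  have := FiniteDimensional.proper ℝ E
  have : LocallyCompactSpace W := W.isOpen.locallyCompactSpace
  have : SigmaCompactSpace W := sigmaCompactSpace_of_locallyCompact_secondCountable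
  let c := CompactExhaustion.choice W
  refine ⟨fun n => ⟨Subtype.val '' c n, (c.isCompact n).image continuous_subtype_val⟩,
    fun n => ?_, fun m n hmn => image_mono (c.subset hmn), fun L hL => ?_⟩
  · rintro _ ⟨x, _, rfl⟩
    exact x.2
  · have hc : IsCompact ((↑) ⁻¹' (L : Set E) : Set W) := by
      rw [Subtype.isCompact_iff]
      convert L.isCompact
      ext x
      exact ⟨fun ⟨y, hy, hyx⟩ => hyx ▸ hy, fun hx => ⟨⟨x, hL hx⟩, hx, rfl⟩⟩
    obtain ⟨n, hn⟩ := c.exists_superset_of_isCompact hc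
    exact ⟨n, fun x hx => ⟨⟨x, hL hx⟩, hn hx, rfl⟩⟩

/-- A strongly bounded set of compactly supported distributions is equicontinuous. -/
theorem exists_uniformlyBoundedBy [FiniteDimensional ℝ E] {W : Opens E} {κ : Type*}
    {g : κ → CompactDistribution W} (hg : Bornology.IsVonNBounded ℂ (range g)) :
    ∃ (K : Compacts E) (M : ℕ) (C : ℝ), 0 < C ∧
      UniformlyBoundedBy (fun p => (g p : SmoothFunctions W →ₗ[ℂ] ℂ)) K M C := by
  obtain ⟨K, hKW, hKmono, hK⟩ := exists_compacts_exhaustion W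
  by_contra! hcon
  -- The estimate fails for `K n`, order `n` and constant `n + 1`; rescaling the offending function
  -- makes its pairing exactly `n + 1` while its derivatives up to order `n` stay at most one on `K
  -- n`.
  have h1 : ∀ n : ℕ, ∃ (p : κ) (ψ : SmoothFunctions W), ‖g p ψ‖ = n + 1 ∧
      ∀ j ≤ n, ∀ x ∈ K n, ‖iteratedFDeriv ℝ j ψ x‖ ≤ 1 := by
    intro n
    have h2 := hcon (K n) n (n + 1) (by positivity)
    simp only [UniformlyBoundedBy, not_and, not_forall, not_le] at h2
    obtain ⟨p, φ, S, hS, hφ, hlt⟩ := h2 (hKW n)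
    have hc : 0 < ‖g p φ‖ := lt_of_le_of_lt (by positivity) hlt
    refine ⟨p, (((n + 1) / ‖g p φ‖ : ℝ) : ℂ) • φ, ?_, fun j hj x hx => ?_⟩
    · rw [map_smul, norm_smul, Complex.norm_real, Real.norm_of_nonneg (by positivity)]
      field_simp
    · rw [SmoothFunctions.iteratedFDeriv_smul _ _ (hKW n hx), norm_smul, Complex.norm_real,
        Real.norm_of_nonneg (by positivity)]
      calc _ ≤ (n + 1) / ‖g p φ‖ * S := by gcongr; exact hφ j hj x hx
        _ ≤ 1 := by
          rw [div_mul_eq_mul_div, div_le_one hc]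
          exact hlt.le
  choose p ψ hψ1 hψ2 using h1
  -- Each seminorm is at most one on all but finitely many `ψ n`, so they form a bounded set, on
  -- which the pairings with a strongly bounded family cannot be unbounded.
  have hb : Bornology.IsVonNBounded ℂ (range ψ) := by
    rw [(SmoothFunctions.withSeminorms W).isVonNBounded_iff_seminorm_bounded]
    rintro ⟨⟨L, hL⟩, k⟩
    obtain ⟨n0, hn0⟩ := hK L hL
    set q := SmoothFunctions.seminormFamily W (⟨L, hL⟩, k)
    have hq : ∀ s : Finset ℕ, 0 ≤ ∑ m ∈ s, q (ψ m) := fun s =>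
      Finset.sum_nonneg fun m _ => apply_nonneg _ _
    refine ⟨2 + ∑ m ∈ Finset.range (max n0 k), q (ψ m), by linarith [hq (Finset.range (max n0 k))],
      ?_⟩
    rintro _ ⟨n, rfl⟩
    by_cases hn : n < max n0 k
    · have := Finset.single_le_sum (f := fun m => q (ψ m)) (fun i _ => apply_nonneg _ _)
        (Finset.mem_range.2 hn)
      linarith
    · have : q (ψ n) ≤ 1 := by
        refine SmoothFunctions.seminorm_le hL k (ψ n) zero_le_one fun x hx => ?_
        exact hψ2 n k ((le_max_right n0 k).trans (not_lt.1 hn)) x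
          (hKmono ((le_max_left n0 k).trans (not_lt.1 hn)) (hn0 hx))
      linarith [hq (Finset.range (max n0 k))]
  have h3 := ContinuousLinearMap.isVonNBounded_image2_apply hg hb
  rw [NormedSpace.isVonNBounded_iff'] at h3
  obtain ⟨r, hr⟩ := h3
  obtain ⟨n, hn⟩ := exists_nat_gt r
  have := hr _ ⟨g (p n), ⟨p n, rfl⟩, ψ n, ⟨n, rfl⟩, rfl⟩
  rw [hψ1 n] at this
  linarith

theorem contDiff_mul_smoothFunctions {W : Opens E} {χ : E → ℂ} (hχ : ContDiff ℝ ∞ χ)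
    (hW : tsupport χ ⊆ W) (φ : SmoothFunctions W) : ContDiff ℝ ∞ fun x => χ x * φ x := by
  refine contDiff_iff_contDiffAt.2 fun x => ?_
  by_cases hx : x ∈ tsupport χ
  · exact hχ.contDiffAt.mul (φ.contDiffAt (hW hx))
  · refine (contDiffAt_const (c := (0 : ℂ))).congr_of_eventuallyEq ?_
    filter_upwards [notMem_tsupport_iff_eventuallyEq.1 hx] with z hz
    simp [hz]

/-- Multiplication by a smooth function `χ` with support in `W'`, from `C^∞(W')` to `C^∞(W)`. -/
def mulCutoff {W' : Opens E} (W : Opens E) (χ : E → ℂ) (hχ : ContDiff ℝ ∞ χ)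
    (hW' : tsupport χ ⊆ W') : SmoothFunctions W' →ₗ[ℂ] SmoothFunctions W where
  toFun φ := SmoothFunctions.restrict W (fun x => χ x * φ x) (contDiff_mul_smoothFunctions hχ hW' φ)
  map_add' φ ψ := by
    refine SmoothFunctions.ext fun x => ?_
    change (W : Set E).indicator (fun x => χ x * (φ x + ψ x)) x
      = (W : Set E).indicator (fun x => χ x * φ x) x + (W : Set E).indicator (fun x => χ x * ψ x) x
    by_cases hx : x ∈ (W : Set E) <;> simp [hx, mul_add]
  map_smul' c φ := by
    refine SmoothFunctions.ext fun x => ?_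
    change (W : Set E).indicator (fun x => χ x * (c * φ x)) x
      = c * (W : Set E).indicator (fun x => χ x * φ x) x
    by_cases hx : x ∈ (W : Set E) <;> simp [hx, mul_left_comm]

theorem norm_iteratedFDeriv_mul_smoothFunctions_le {W : Opens E} {χ : E → ℂ}
    (hχ : ContDiff ℝ ∞ χ) (φ : SmoothFunctions W) {x : E} (hx : x ∈ W)
    {B S : ℝ} {n : ℕ} (hB : ∀ j ≤ n, ‖iteratedFDeriv ℝ j χ x‖ ≤ B)
    (hS : ∀ j ≤ n, ‖iteratedFDeriv ℝ j φ x‖ ≤ S) :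
    ‖iteratedFDeriv ℝ n (fun x => χ x * φ x) x‖ ≤ 2 ^ n * B * S := by
  have h := norm_iteratedFDerivWithin_mul_le (hχ.contDiffOn (s := W)) φ.contDiffOn
    W.isOpen.uniqueDiffOn hx (n := n) (by exact_mod_cast le_top)
  simp only [iteratedFDerivWithin_of_isOpen _ W.isOpen hx] at h
  have hB0 : 0 ≤ B := (norm_nonneg _).trans (hB 0 (Nat.zero_le _))
  have hS0 : 0 ≤ S := (norm_nonneg _).trans (hS 0 (Nat.zero_le _))
  refine h.trans ?_
  calc _ ≤ ∑ i ∈ Finset.range (n + 1), (n.choose i : ℝ) * B * S := by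
        refine Finset.sum_le_sum fun i hi => ?_
        rw [Finset.mem_range] at hi
        gcongr
        · exact hB i (by omega)
        · exact hS (n - i) (by omega)
    _ = 2 ^ n * B * S := by
        rw [← Finset.sum_mul, ← Finset.sum_mul]
        congr 2
        exact_mod_cast Nat.sum_range_choose n

/-- Multiplying a uniformly bounded family of distributions by a uniformly bounded family of
cutoff functions. -/
theorem UniformlyBoundedBy.comp_mulCutoff {W W' : Opens E} {κ : Type*}
    {g : κ → CompactDistribution W} {K : Compacts E} {M : ℕ} {C : ℝ}
    (h : UniformlyBoundedBy (fun p => (g p : SmoothFunctions W →ₗ[ℂ] ℂ)) K M C)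
    {χ : κ → E → ℂ} (hχ : ∀ p, ContDiff ℝ ∞ (χ p)) {T : Compacts E} (hT : (T : Set E) ⊆ W')
    (hχT : ∀ p, tsupport (χ p) ⊆ T) {B : ℝ}
    (hB : ∀ p, ∀ j ≤ M, ∀ x, ‖iteratedFDeriv ℝ j (χ p) x‖ ≤ B) :
    UniformlyBoundedBy (fun p => (g p : SmoothFunctions W →ₗ[ℂ] ℂ) ∘ₗ
      mulCutoff W (χ p) (hχ p) ((hχT p).trans hT)) T M (C * (2 ^ M * B)) := by
  refine ⟨hT, fun p φ S hS hφ => ?_⟩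
  have hB0 : 0 ≤ B := (norm_nonneg _).trans (hB p 0 (Nat.zero_le _) 0)
  refine (h.2 p _ (2 ^ M * B * S) (by positivity) fun j hj x hx => ?_).trans (by linarith)
  change ‖iteratedFDeriv ℝ j (SmoothFunctions.restrict W (fun x => χ p x * φ x)
    (contDiff_mul_smoothFunctions (hχ p) ((hχT p).trans hT) φ)) x‖ ≤ _
  rw [SmoothFunctions.iteratedFDeriv_restrict _ (h.1 hx)]
  by_cases hxT : x ∈ tsupport (χ p)
  · refine (norm_iteratedFDeriv_mul_smoothFunctions_le (hχ p) φ (hT (hχT p hxT))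
      (fun i hi => hB p i (hi.trans hj) x)
      (fun i hi => hφ i (hi.trans hj) x (hχT p hxT))).trans ?_
    gcongr
    · norm_num
  · have h1 : x ∉ tsupport fun x => χ p x * φ x := fun hc => hxT (tsupport_mul_subset_left hc)
    have h2 := notMem_tsupport_iff_eventuallyEq.1 h1
    rw [(Filter.EventuallyEq.iteratedFDeriv ℝ h2 j).eq_of_nhds]
    change ‖iteratedFDeriv ℝ j (fun _ => (0 : ℂ)) x‖ ≤ _
    rw [iteratedFDeriv_fun_zero]
    simp only [Pi.zero_apply, norm_zero]
    positivity

end CompactDistributions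

/-! ### Derivative bounds for functions of linear forms and for products. -/

section PlaneWaves

variable {E : Type*} [NormedAddCommGroup E] [InnerProductSpace ℝ E]

theorem norm_iteratedFDeriv_comp_inner_le {g : ℝ → ℂ} (hg : ContDiff ℝ ∞ g) (v : E) (c : ℝ)
    {n : ℕ} {B : ℝ} (hB : ∀ s, ‖iteratedDeriv n g s‖ ≤ B) (x : E) :
    ‖iteratedFDeriv ℝ n (fun x => g (inner ℝ x v - c)) x‖ ≤ B * ‖v‖ ^ n := by
  have h1 : (fun x : E => g (inner ℝ x v - c)) = (fun s => g (s - c)) ∘ innerSL ℝ v := by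
    funext x
    simp [real_inner_comm]
  have h2 : ContDiff ℝ ∞ fun s => g (s - c) := hg.comp (contDiff_id.sub contDiff_const)
  rw [h1, (innerSL ℝ v).iteratedFDeriv_comp_right h2 x (by exact_mod_cast le_top)]
  refine (ContinuousMultilinearMap.norm_compContinuousLinearMap_le _ _).trans ?_
  rw [iteratedFDeriv_comp_sub, norm_iteratedFDeriv_eq_norm_iteratedDeriv]
  simp only [innerSL_apply_norm, Finset.prod_const, Finset.card_univ, Fintype.card_fin]
  gcongr
  exact hB _

theorem exists_norm_iteratedFDeriv_prod_le {κ ι : Type*} {F : ι → κ → E → ℂ}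
    (hF : ∀ i p, ContDiff ℝ ∞ (F i p))
    (hB : ∀ i j, ∃ B, ∀ p x, ‖iteratedFDeriv ℝ j (F i p) x‖ ≤ B) (s : Finset ι) (j : ℕ) :
    ∃ B, ∀ p x, ‖iteratedFDeriv ℝ j (fun x => ∏ i ∈ s, F i p x) x‖ ≤ B := by
  classical
  induction s using Finset.induction_on generalizing j with
  | empty =>
    refine ⟨1, fun p x => ?_⟩
    simp only [Finset.prod_empty]
    rcases j with _ | j
    · simp
    · rw [iteratedFDeriv_const_of_ne (Nat.succ_ne_zero j)]
      simp
  | insert a s ha ih =>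
    choose B1 h1 using hB a
    choose B2 h2 using ih
    refine ⟨∑ i ∈ Finset.range (j + 1), (j.choose i : ℝ) * B1 i * B2 (j - i), fun p x => ?_⟩
    simp only [Finset.prod_insert ha]
    refine (norm_iteratedFDeriv_mul_le (N := ∞) (hF a p)
      (contDiff_prod fun i _ => hF i p) x (by exact_mod_cast le_top)).trans ?_
    refine Finset.sum_le_sum fun i _ => ?_
    have : 0 ≤ B1 i := (norm_nonneg _).trans (h1 i p x)
    gcongr
    · exact h1 i p x
    · exact h2 (j - i) p x

end PlaneWaves

/-! ### Plane waves, and termwise evaluation of plane wave series. -/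

section Waves

variable {d : ℕ}

/-- The plane wave `x ↦ exp(-2π i x·ξ)`. -/
def wave (ξ x : EuclideanSpace ℝ (Fin d)) : ℂ :=
  Complex.exp (-2 * Real.pi * Complex.I * (inner ℝ x ξ : ℝ))

theorem contDiff_wave' (ξ : EuclideanSpace ℝ (Fin d)) : ContDiff ℝ ∞ (wave ξ) := contDiff_wave ξ

theorem norm_iteratedFDeriv_wave_le (ξ x : EuclideanSpace ℝ (Fin d)) (n : ℕ) :
    ‖iteratedFDeriv ℝ n (wave ξ) x‖ ≤ (2 * Real.pi * ‖ξ‖) ^ n := by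
  have hs : ContDiff ℝ ∞ fun s : ℝ => Complex.exp (-2 * Real.pi * Complex.I * (s : ℝ)) :=
    (contDiff_const.mul Complex.ofRealCLM.contDiff).cexp
  have hd : ∀ (n : ℕ) (s : ℝ), iteratedDeriv n
      (fun s : ℝ => Complex.exp (-2 * Real.pi * Complex.I * (s : ℝ))) s
        = (-2 * Real.pi * Complex.I) ^ n * Complex.exp (-2 * Real.pi * Complex.I * (s : ℝ)) := by
    intro n
    induction n with
    | zero => simp
    | succ n ih =>
      intro s
      rw [iteratedDeriv_succ, funext ih]
      have h1 : HasDerivAt (fun s : ℝ => -2 * Real.pi * Complex.I * (s : ℂ))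
          (-2 * Real.pi * Complex.I) s := by
        simpa using (Complex.ofRealCLM.hasDerivAt (x := s)).const_mul (-2 * Real.pi * Complex.I)
      rw [(h1.cexp.const_mul _).deriv]
      ring
  have h := norm_iteratedFDeriv_comp_inner_le hs ξ 0 (n := n) (B := (2 * Real.pi) ^ n)
    (fun s => by
      rw [hd, norm_mul, norm_pow]
      have : ‖Complex.exp (-2 * Real.pi * Complex.I * (s : ℝ))‖ = 1 := by
        have := norm_exp_two_pi_I (-s)
        push_cast at this
        rw [← this]
        congr 2
        ring
      rw [this]
      simp [abs_of_pos Real.pi_pos]) x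
  rw [mul_pow]
  simp only [sub_zero] at h
  exact h

theorem norm_wave (ξ x : EuclideanSpace ℝ (Fin d)) : ‖wave ξ x‖ = 1 := by
  have := norm_exp_two_pi_I (-inner ℝ x ξ)
  rw [← this, wave]
  congr 2
  push_cast
  ring

variable {W : Opens (EuclideanSpace ℝ (Fin d))} {κ : Type*} {g : κ → CompactDistribution W}
  {K : Compacts (EuclideanSpace ℝ (Fin d))} {M : ℕ} {C : ℝ}

theorem fourierCompact_eq (u : CompactDistribution W) (ξ : EuclideanSpace ℝ (Fin d)) :
    fourierCompact u ξ = u (SmoothFunctions.restrict W (wave ξ) (contDiff_wave ξ)) := rfl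

theorem UniformlyBoundedBy.norm_fourierCompact_le
    (h : UniformlyBoundedBy (fun p => (g p : SmoothFunctions W →ₗ[ℂ] ℂ)) K M C) (p : κ)
    (ξ : EuclideanSpace ℝ (Fin d)) :
    ‖fourierCompact (g p) ξ‖ ≤ C * (1 + 2 * Real.pi * ‖ξ‖) ^ M := by
  have hpos : 0 ≤ 2 * Real.pi * ‖ξ‖ := by positivity
  refine h.2 p _ _ (by positivity) fun j hj x hx => ?_
  rw [SmoothFunctions.iteratedFDeriv_restrict _ (h.1 hx)]
  refine (norm_iteratedFDeriv_wave_le ξ x j).trans ?_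
  calc (2 * Real.pi * ‖ξ‖) ^ j ≤ (1 + 2 * Real.pi * ‖ξ‖) ^ j := by gcongr; linarith
    _ ≤ _ := pow_le_pow_right₀ (by linarith) hj

/-- A compactly supported distribution may be applied termwise to a rapidly convergent series of
plane waves. -/
theorem UniformlyBoundedBy.hasSum_wave
    (h : UniformlyBoundedBy (fun p => (g p : SmoothFunctions W →ₗ[ℂ] ℂ)) K M C) (p : κ)
    {ι : Type*} {c : ι → ℂ} {μ : ι → EuclideanSpace ℝ (Fin d)}
    (hc : ∀ k : ℕ, Summable fun i => ‖c i‖ * ‖μ i‖ ^ k) {F : SmoothFunctions W}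
    {O : Set (EuclideanSpace ℝ (Fin d))} (hO : IsOpen O) (hKO : (K : Set _) ⊆ O)
    (hF : ∀ x ∈ O, F x = ∑' i, c i * wave (μ i) x) :
    HasSum (fun i => c i * fourierCompact (g p) (μ i)) (g p F) := by
  have hsm : ∀ i, ContDiff ℝ ∞ fun x => c i * wave (μ i) x := fun i =>
    contDiff_const.mul (contDiff_wave (μ i))
  have hv : ∀ k : ℕ, Summable fun i => ‖c i‖ * (2 * Real.pi * ‖μ i‖) ^ k := fun k => by
    refine ((hc k).mul_left ((2 * Real.pi) ^ k)).congr fun i => ?_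
    rw [mul_pow]; ring
  have hbd : ∀ (k : ℕ) (i : ι) x, ‖iteratedFDeriv ℝ k (fun x => c i * wave (μ i) x) x‖
      ≤ ‖c i‖ * (2 * Real.pi * ‖μ i‖) ^ k := fun k i x => by
    have e : iteratedFDeriv ℝ k (fun x => c i * wave (μ i) x) x
        = c i • iteratedFDeriv ℝ k (wave (μ i)) x := by
      change iteratedFDeriv ℝ k (c i • wave (μ i)) x = _
      exact iteratedFDeriv_const_smul_apply (((contDiff_wave' (μ i)).of_le
        (by exact_mod_cast le_top)).contDiffAt)
    rw [e, norm_smul]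
    gcongr
    exact norm_iteratedFDeriv_wave_le _ _ _
  -- The remainder of the series has derivatives up to order `M` bounded by the tails of convergent
  -- numerical series. As the expansion holds on an open set containing `K`, it may be
  -- differentiated at points of `K`, and the estimate for `g p` gives convergence.
  let tail : Finset ι → ℝ := fun s => ∑ j ∈ Finset.range (M + 1),
    ∑' i : {i // i ∉ s}, ‖c i‖ * (2 * Real.pi * ‖μ i‖) ^ j
  have htail0 : ∀ (s : Finset ι) (j : ℕ),
      0 ≤ ∑' i : {i // i ∉ s}, ‖c i‖ * (2 * Real.pi * ‖μ i‖) ^ j := fun s j =>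
    tsum_nonneg fun i => by positivity
  have htail : Filter.Tendsto tail Filter.atTop (nhds 0) := by
    have := tendsto_finsetSum (Finset.range (M + 1)) fun j _ =>
      tendsto_tsum_compl_atTop_zero fun i => ‖c i‖ * (2 * Real.pi * ‖μ i‖) ^ j
    simpa using this
  have hest : ∀ s : Finset ι, ‖g p F - ∑ i ∈ s, c i * fourierCompact (g p) (μ i)‖ ≤ C * tail s := by
    intro s
    let e : ι → SmoothFunctions W := fun i =>
      c i • SmoothFunctions.restrict W (wave (μ i)) (contDiff_wave (μ i))
    have h1 : g p F - ∑ i ∈ s, c i * fourierCompact (g p) (μ i) = g p (F - ∑ i ∈ s, e i) := by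
      rw [map_sub, map_sum]
      congr 1
      refine Finset.sum_congr rfl fun i _ => ?_
      rw [map_smul, smul_eq_mul, fourierCompact_eq]
    rw [h1]
    refine h.2 p _ _ (Finset.sum_nonneg fun j _ => htail0 s j) fun j hj x hx => ?_
    have h2 : (F - ∑ i ∈ s, e i : SmoothFunctions W) =ᶠ[nhds x]
        fun y => ∑' i : {i // i ∉ s}, c i * wave (μ i) y := by
      filter_upwards [hO.mem_nhds (hKO hx), W.isOpen.mem_nhds (h.1 hx)] with y hyO hyW
      have h3 : (F - ∑ i ∈ s, e i : SmoothFunctions W) y = F y - ∑ i ∈ s, c i * wave (μ i) y := by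
        have hev : ∀ t : Finset ι, (∑ i ∈ t, e i : SmoothFunctions W) y
            = ∑ i ∈ t, c i * wave (μ i) y := by
          classical
          intro t
          induction t using Finset.induction_on with
          | empty => rfl
          | insert a t ha ih =>
            rw [Finset.sum_insert ha, Finset.sum_insert ha, ← ih]
            change c a * (W : Set _).indicator (wave (μ a)) y + _ = _
            rw [indicator_of_mem hyW]
        rw [← hev s]
        rfl
      have hs : Summable fun i => c i * wave (μ i) y := by
        refine Summable.of_norm_bounded (hc 0) fun i => ?_
        rw [norm_mul, norm_wave, pow_zero]
      rw [h3, hF y hyO, sub_eq_iff_eq_add']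
      exact (hs.sum_add_tsum_subtype_compl s).symm
    rw [(Filter.EventuallyEq.iteratedFDeriv ℝ h2 j).eq_of_nhds,
      iteratedFDeriv_tsum_apply (N := ⊤)
        (v := fun k (i : {i // i ∉ s}) => ‖c i‖ * (2 * Real.pi * ‖μ i‖) ^ k)
        (fun i => hsm i) (fun k _ => (hv k).subtype _) (fun k i x _ => hbd k i x) le_top]
    refine (tsum_of_norm_bounded ((hv j).subtype {i | i ∉ s}).hasSum fun i => hbd j i.1 x).trans ?_
    exact Finset.single_le_sum
      (f := fun j => ∑' i : {i // i ∉ s}, ‖c i‖ * (2 * Real.pi * ‖μ i‖) ^ j)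
      (fun i _ => htail0 s i) (Finset.mem_range.2 (by omega))
  rw [HasSum, tendsto_iff_norm_sub_tendsto_zero]
  refine squeeze_zero (fun _ => norm_nonneg _) (fun s => ?_)
    (by simpa using htail.const_mul C)
  rw [norm_sub_rev]
  exact hest s

end Waves

/-! ### Weighted product bounds, and shrinking of cones. -/

section LatticeEstimates

/-- Of the `k + 2` powers of decay, `k` absorb polynomial growth and two remain for summation over
the lattice. -/
theorem pow_prod_mul_prod_le {d k : ℕ} {F : ℝ → ℝ} {B : ℝ} (hF : ∀ t, 0 ≤ F t)
    (hdec : ∀ t, (1 + |t|) ^ (k + 2) * F t ≤ B) (z : Fin d → ℝ) :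
    (∏ i, (1 + |z i|)) ^ k * ∏ i, F (z i) ≤ B ^ d * ∏ i, ((1 + |z i|) ^ 2)⁻¹ := by
  have hB : B ^ d = ∏ _i : Fin d, B := by simp
  rw [← Finset.prod_pow, ← Finset.prod_mul_distrib, hB, ← Finset.prod_mul_distrib]
  refine Finset.prod_le_prod (fun i _ => mul_nonneg (by positivity) (hF _)) fun i _ => ?_
  rw [← div_eq_mul_inv, le_div_iff₀ (by positivity)]
  calc (1 + |z i|) ^ k * F (z i) * (1 + |z i|) ^ 2 = (1 + |z i|) ^ (k + 2) * F (z i) := by ring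
    _ ≤ B := hdec _

/-- Only the factor in coordinate `m` is asked for the `N`-th power, so `R`, later `C ^ N * N!`,
enters once rather than `d` times. The application takes `m` to be the largest coordinate. -/
theorem max_pow_mul_pow_prod_mul_prod_le {d k N : ℕ} {F : ℝ → ℝ} {B R : ℝ} (hF : ∀ t, 0 ≤ F t)
    (hdec : ∀ t, (1 + |t|) ^ (k + 2) * F t ≤ B)
    (hdecN : ∀ t, (1 + |t|) ^ (k + 2) * (|t| ^ N * F t) ≤ B * R) (z : Fin d → ℝ) (m : Fin d) :
    |z m| ^ N * ((∏ i, (1 + |z i|)) ^ k * ∏ i, F (z i))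
      ≤ B ^ d * R * ∏ i, ((1 + |z i|) ^ 2)⁻¹ := by
  have hB0 : 0 ≤ B := (mul_nonneg (by positivity) (hF 0)).trans (hdec 0)
  have hBR : B ^ d * R = ∏ i : Fin d, (B * if i = m then R else 1) := by
    rw [Finset.prod_mul_distrib]
    simp
  have hz : |z m| ^ N = ∏ i : Fin d, if i = m then |z i| ^ N else 1 := by
    simp
  rw [hBR, hz, ← Finset.prod_pow, ← Finset.prod_mul_distrib, ← Finset.prod_mul_distrib,
    ← Finset.prod_mul_distrib]
  refine Finset.prod_le_prod (fun i _ => ?_) fun i _ => ?_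
  · have := hF (z i)
    split_ifs <;> positivity
  · rw [← div_eq_mul_inv, le_div_iff₀ (by positivity)]
    split_ifs
    · calc _ = (1 + |z i|) ^ (k + 2) * (|z i| ^ N * F (z i)) := by ring
        _ ≤ B * R := hdecN _
    · calc _ = (1 + |z i|) ^ (k + 2) * F (z i) := by ring
        _ ≤ B := hdec _
        _ = B * 1 := (mul_one B).symm

variable {E : Type*} [NormedAddCommGroup E] [NormedSpace ℝ E] {d : ℕ}

theorem norm_sum_smul_le (b : Fin d → E) (z : Fin d → ℝ) (m : Fin d)
    (hm : ∀ i, |z i| ≤ |z m|) : ‖∑ i, z i • b i‖ ≤ (∑ i, ‖b i‖) * |z m| := by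
  rw [Finset.sum_mul]
  refine norm_sum_le_of_le _ fun i _ => ?_
  rw [norm_smul, mul_comm, Real.norm_eq_abs]
  exact mul_le_mul_of_nonneg_left (hm i) (norm_nonneg _)

theorem norm_sum_smul_le_prod (b : Fin d → E) (z : Fin d → ℝ) :
    ‖∑ i, z i • b i‖ ≤ (∑ i, ‖b i‖) * ∏ i, (1 + |z i|) := by
  rw [Finset.sum_mul]
  refine norm_sum_le_of_le _ fun i _ => ?_
  rw [norm_smul, mul_comm, Real.norm_eq_abs]
  gcongr
  have h : ∀ j, (1 : ℝ) ≤ 1 + |z j| := fun j => by linarith [abs_nonneg (z j)]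
  rw [← Finset.mul_prod_erase Finset.univ _ (Finset.mem_univ i)]
  have h2 : 1 ≤ ∏ j ∈ Finset.univ.erase i, (1 + |z j|) := Finset.one_le_prod fun j _ => h j
  nlinarith [abs_nonneg (z i), h i]

theorem norm_sum_smul_pow_mul_prod_le {k N : ℕ} {F : ℝ → ℝ} {B R : ℝ} (hd : 0 < d)
    (hF : ∀ t, 0 ≤ F t) (hdec : ∀ t, (1 + |t|) ^ (k + 2) * F t ≤ B)
    (hdecN : ∀ t, (1 + |t|) ^ (k + 2) * (|t| ^ N * F t) ≤ B * R) (b : Fin d → E) (z : Fin d → ℝ) :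
    ‖∑ i, z i • b i‖ ^ N * ((∏ i, (1 + |z i|)) ^ k * ∏ i, F (z i))
      ≤ (∑ i, ‖b i‖) ^ N * (B ^ d * R * ∏ i, ((1 + |z i|) ^ 2)⁻¹) := by
  obtain ⟨m, -, hm⟩ := Finset.exists_max_image Finset.univ (fun i => |z i|) ⟨⟨0, hd⟩, by simp⟩
  have h1 := norm_sum_smul_le b z m fun i => hm i (Finset.mem_univ i)
  have hF' : 0 ≤ ∏ i, F (z i) := Finset.prod_nonneg fun i _ => hF _
  calc _ ≤ ((∑ i, ‖b i‖) * |z m|) ^ N * ((∏ i, (1 + |z i|)) ^ k * ∏ i, F (z i)) := by gcongr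
    _ = (∑ i, ‖b i‖) ^ N * (|z m| ^ N * ((∏ i, (1 + |z i|)) ^ k * ∏ i, F (z i))) := by
      rw [mul_pow]; ring
    _ ≤ _ := mul_le_mul_of_nonneg_left (max_pow_mul_pow_prod_mul_prod_le hF hdec hdecN z m)
      (by positivity)

/-- Inside a smaller cone, a point at small relative distance stays in the given cone. -/
theorem exists_smaller_cone {Γ : Set E} {ξ₀ : E} (hξ₀ : ξ₀ ≠ 0) (hΓ : IsOpenConicNhd Γ ξ₀) :
    ∃ (Γ' : Set E) (c : ℝ), IsOpenConicNhd Γ' ξ₀ ∧ 0 < c ∧ ∀ ξ ∈ Γ', ∀ η : E,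
      (η ∈ Γ ∧ ‖ξ‖ ≤ 2 * ‖η‖) ∨ c * ‖ξ‖ ≤ ‖ξ - η‖ := by
  obtain ⟨hΓo, hΓ0, hΓc⟩ := hΓ
  obtain ⟨ε, hε, hεΓ⟩ := Metric.isOpen_iff.1 hΓo ξ₀ hΓ0
  have hn : 0 < ‖ξ₀‖ := norm_pos_iff.2 hξ₀
  -- If `t • ξ` is within `r` of `ξ₀` and `η` is closer to `ξ` than `r / (‖ξ₀‖ + r) * ‖ξ‖`, then `t
  -- • η` is within `2 * r ≤ ε` of `ξ₀`. The bound `r ≤ ‖ξ₀‖` makes the ratio at most `1 / 2`,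
  -- whence `‖ξ‖ ≤ 2 * ‖η‖`.
  set r := min (ε / 2) ‖ξ₀‖ with hr
  have hr0 : 0 < r := lt_min (by positivity) hn
  have hrε : 2 * r ≤ ε := by linarith [min_le_left (ε / 2) ‖ξ₀‖]
  have hrn : r ≤ ‖ξ₀‖ := min_le_right _ _
  refine ⟨⋃ t : {t : ℝ // 0 < t}, (fun ξ => (t : ℝ) • ξ) ⁻¹' Metric.ball ξ₀ r,
    r / (‖ξ₀‖ + r), ⟨?_, ?_, ?_⟩, by positivity, ?_⟩
  · exact isOpen_iUnion fun t => Metric.isOpen_ball.preimage (continuous_const_smul _)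
  · exact mem_iUnion.2 ⟨⟨1, one_pos⟩, by simpa using hr0⟩
  · intro ξ hξ s hs
    obtain ⟨⟨t, ht⟩, htξ⟩ := mem_iUnion.1 hξ
    refine mem_iUnion.2 ⟨⟨t / s, div_pos ht hs⟩, ?_⟩
    have e : (t / s) • (s • ξ) = t • ξ := by rw [smul_smul, div_mul_cancel₀ _ hs.ne']
    simp only [mem_preimage] at htξ ⊢
    rwa [e]
  · intro ξ hξ η
    obtain ⟨⟨t, ht⟩, htξ⟩ := mem_iUnion.1 hξ
    simp only [mem_preimage, mem_ball_iff_norm] at htξ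
    by_cases hfar : r / (‖ξ₀‖ + r) * ‖ξ‖ ≤ ‖ξ - η‖
    · exact Or.inr hfar
    · left
      rw [not_le] at hfar
      have htn : t * ‖ξ‖ ≤ ‖ξ₀‖ + r := by
        have : ‖t • ξ‖ ≤ ‖t • ξ - ξ₀‖ + ‖ξ₀‖ := norm_le_norm_sub_add _ _
        rw [norm_smul, Real.norm_of_nonneg ht.le] at this
        linarith
      have hc2 : r / (‖ξ₀‖ + r) ≤ 1 / 2 := by
        rw [div_le_div_iff₀ (by positivity) (by positivity)]
        linarith
      constructor
      · have h1 : ‖t • η - ξ₀‖ < 2 * r := by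
          have h2 : ‖t • η - ξ₀‖ ≤ ‖t • (ξ - η)‖ + ‖t • ξ - ξ₀‖ := by
            have : t • η - ξ₀ = -(t • (ξ - η)) + (t • ξ - ξ₀) := by rw [smul_sub]; abel
            rw [this]
            exact (norm_add_le _ _).trans (by rw [norm_neg])
          have h3 : ‖t • (ξ - η)‖ ≤ r := by
            rw [norm_smul, Real.norm_of_nonneg ht.le]
            calc t * ‖ξ - η‖ ≤ t * (r / (‖ξ₀‖ + r) * ‖ξ‖) := by gcongr
              _ = r / (‖ξ₀‖ + r) * (t * ‖ξ‖) := by ring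
              _ ≤ r / (‖ξ₀‖ + r) * (‖ξ₀‖ + r) := by gcongr
              _ = r := by field_simp
          linarith
        have h4 : t • η ∈ Γ := hεΓ (mem_ball_iff_norm.2 (h1.trans_le hrε))
        have h5 := hΓc _ h4 t⁻¹ (inv_pos.2 ht)
        rwa [smul_smul, inv_mul_cancel₀ ht.ne', one_smul] at h5
      · have h1 : ‖ξ‖ ≤ ‖ξ - η‖ + ‖η‖ := norm_le_norm_sub_add _ _
        have h2 : r / (‖ξ₀‖ + r) * ‖ξ‖ ≤ 1 / 2 * ‖ξ‖ := by gcongr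
        linarith

end LatticeEstimates

/-! ### Separation from integer points, and norm control by coordinates. -/

section Coordinates

variable {d : ℕ}

/-- The integer vectors of norm at least one form a closed set disjoint from the compact set `K`, so
the two have disjoint thickenings. -/
theorem exists_separation_from_integers {K : Set (Fin d → ℝ)} (hK : IsCompact K)
    (hK0 : ∀ y ∈ K, ∀ k : Fin d → ℤ, (∀ i, y i = k i) → k = 0) :
    ∃ δ > 0, ∃ O : Set (Fin d → ℝ), IsOpen O ∧ K ⊆ O ∧
      ∀ y ∈ O, ∀ k : Fin d → ℤ, (∀ i, |y i + k i| < δ) → k = 0 := by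
  let Z : Set (Fin d → ℝ) := {x | (∀ i, x i ∈ range ((↑) : ℤ → ℝ)) ∧ 1 ≤ ‖x‖}
  have hZ : IsClosed Z := by
    have hZ' : Z = (⋂ i, (fun x : Fin d → ℝ => x i) ⁻¹' range ((↑) : ℤ → ℝ)) ∩ {x | 1 ≤ ‖x‖} := by
      ext; simp [Z]
    rw [hZ']
    refine IsClosed.inter ?_ (isClosed_le continuous_const continuous_norm)
    exact isClosed_iInter fun i =>
      Int.isClosedEmbedding_coe_real.isClosed_range.preimage (continuous_apply i)
  have hdisj : Disjoint K Z := by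
    rw [Set.disjoint_left]
    rintro y hyK ⟨hyZ, hy1⟩
    choose k hk using hyZ
    have := hK0 y hyK k fun i => (hk i).symm
    subst this
    have hy : y = 0 := by
      funext i
      rw [← hk i]
      simp
    rw [hy, norm_zero] at hy1
    linarith
  obtain ⟨δ, hδ, hdis⟩ := hdisj.exists_thickenings hK hZ
  refine ⟨δ, hδ, Metric.thickening δ K, Metric.isOpen_thickening,
    Metric.self_subset_thickening hδ K, fun y hy k hk => ?_⟩
  by_contra hk0
  refine Set.disjoint_left.1 hdis hy (Metric.mem_thickening_iff.2
    ⟨fun i => -(k i : ℝ), ⟨fun i => ⟨-k i, by push_cast; rfl⟩, ?_⟩, ?_⟩)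
  · obtain ⟨i, hi⟩ := Function.ne_iff.1 hk0
    refine le_trans ?_ (norm_le_pi_norm _ i)
    rw [norm_neg, Real.norm_eq_abs]
    exact_mod_cast Int.one_le_abs hi
  · rw [dist_pi_lt_iff hδ]
    intro i
    rw [Real.dist_eq, sub_neg_eq_add]
    exact hk i

theorem exists_norm_le_of_abs_inner_le {E : Type*} [NormedAddCommGroup E] [InnerProductSpace ℝ E]
    (b : Module.Basis (Fin d) ℝ E) :
    ∃ A > 0, ∀ (x : E) (δ : ℝ), 0 ≤ δ → (∀ i, |inner ℝ x (b i)| ≤ δ) → ‖x‖ ≤ A * δ := by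
  have : FiniteDimensional ℝ E := b.finiteDimensional_of_finite
  let L : E →ₗ[ℝ] (Fin d → ℝ) := LinearMap.pi fun i => (innerₗ E (b i))
  have hL : LinearMap.ker L = ⊥ := by
    rw [LinearMap.ker_eq_bot']
    intro x hx
    have h1 : innerₗ E x = 0 := b.ext fun i => by
      simpa [L, real_inner_comm] using congrFun hx i
    exact inner_self_eq_zero.1 (LinearMap.congr_fun h1 x)
  obtain ⟨A, hA, hAL⟩ := L.exists_antilipschitzWith hL
  refine ⟨A, by exact_mod_cast hA, fun x δ hδ h => ?_⟩
  have h1 := hAL.le_mul_dist x 0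
  rw [map_zero, dist_zero_right, dist_zero_right] at h1
  refine h1.trans ?_
  gcongr
  rw [pi_norm_le_iff_of_nonneg hδ]
  intro i
  simpa [L, real_inner_comm] using h i

end Coordinates

/-! ### Expansion of a localized plane wave into lattice plane waves. -/

section Expansion

open scoped FourierTransform

variable {d : ℕ}

/-- The product of one-dimensional cutoffs `θ` in the coordinates `(x - x₀)·bᵢ`. -/
def productCutoff (b : Fin d → EuclideanSpace ℝ (Fin d)) (x₀ : EuclideanSpace ℝ (Fin d))
    (θ : ℝ → ℂ) (x : EuclideanSpace ℝ (Fin d)) : ℂ :=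
  ∏ i, θ (inner ℝ x (b i) - inner ℝ x₀ (b i))

variable {b : Fin d → EuclideanSpace ℝ (Fin d)} {x₀ : EuclideanSpace ℝ (Fin d)} {θ : ℝ → ℂ}

theorem contDiff_productCutoff (hθ : ContDiff ℝ ∞ θ) : ContDiff ℝ ∞ (productCutoff b x₀ θ) :=
  contDiff_prod fun _ _ => hθ.comp ((contDiff_id.inner ℝ contDiff_const).sub contDiff_const)

/-- The lattice point `-∑ nᵢ bᵢ`. -/
def latticePoint (b : Fin d → EuclideanSpace ℝ (Fin d)) (n : Fin d → ℤ) :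
    EuclideanSpace ℝ (Fin d) :=
  ∑ i, (-(n i : ℝ)) • b i

theorem wave_sum_smul (b : Fin d → EuclideanSpace ℝ (Fin d)) (x₀ x : EuclideanSpace ℝ (Fin d))
    (ζ : Fin d → ℝ) :
    wave (∑ i, ζ i • b i) x = wave (∑ i, ζ i • b i) x₀ *
      ∏ i, Complex.exp (-2 * Real.pi * Complex.I *
        (ζ i * (inner ℝ x (b i) - inner ℝ x₀ (b i)) : ℝ)) := by
  rw [← Complex.exp_sum, wave, wave, ← Complex.exp_add, ← Finset.mul_sum, ← mul_add]
  congr 2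
  simp only [inner_sum, real_inner_smul_right]
  push_cast
  rw [← Finset.sum_add_distrib]
  exact Finset.sum_congr rfl fun i _ => by ring

theorem wave_latticePoint (b : Fin d → EuclideanSpace ℝ (Fin d))
    (x₀ x : EuclideanSpace ℝ (Fin d)) (n : Fin d → ℤ) :
    wave (latticePoint b n) x = wave (latticePoint b n) x₀ *
      ∏ i, Complex.exp (2 * Real.pi * Complex.I *
        (n i * (inner ℝ x (b i) - inner ℝ x₀ (b i)) : ℝ)) := by
  rw [latticePoint, wave_sum_smul b x₀ x]
  congr 1
  refine Finset.prod_congr rfl fun i _ => ?_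
  congr 1
  push_cast
  ring

/-- The coefficients in the expansion of `χ(x) exp(-2π i x·ξ)` into plane waves with frequencies in
a lattice. -/
def waveCoeff (b : Fin d → EuclideanSpace ℝ (Fin d)) (x₀ : EuclideanSpace ℝ (Fin d)) (θ : ℝ → ℂ)
    (ζ : Fin d → ℝ) (n : Fin d → ℤ) : ℂ :=
  wave (∑ i, ζ i • b i) x₀ * (wave (latticePoint b n) x₀)⁻¹ * ∏ i, 𝓕 θ (ζ i + n i)

theorem norm_waveCoeff (ζ : Fin d → ℝ) (n : Fin d → ℤ) :
    ‖waveCoeff b x₀ θ ζ n‖ = ∏ i, ‖𝓕 θ (ζ i + n i)‖ := by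
  rw [waveCoeff, norm_mul, norm_mul, norm_inv, norm_wave, norm_wave, norm_prod]
  simp

theorem tsum_waveCoeff_mul_wave {δ : ℝ} (hδ : δ ≤ 1 / 2) (hθ : ContDiff ℝ ∞ θ)
    (hθ0 : ∀ x, δ ≤ |x| → θ x = 0) {B : ℝ} (hdec : ∀ t, (1 + |t|) ^ 2 * ‖𝓕 θ t‖ ≤ B)
    (ζ : Fin d → ℝ) {x : EuclideanSpace ℝ (Fin d)}
    (hx : ∀ k : Fin d → ℤ, (∀ i, |inner ℝ x (b i) - inner ℝ x₀ (b i) + k i| < δ) → k = 0) :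
    productCutoff b x₀ θ x * wave (∑ i, ζ i • b i) x
      = ∑' n, waveCoeff b x₀ θ ζ n * wave (latticePoint b n) x := by
  have h := tsum_prod_fourier_eq hδ hθ hθ0 hdec ζ _ hx
  have h1 : ∀ n, waveCoeff b x₀ θ ζ n * wave (latticePoint b n) x
      = wave (∑ i, ζ i • b i) x₀ * ∏ i, (𝓕 θ (ζ i + n i) *
        Complex.exp (2 * Real.pi * Complex.I *
          (n i * (inner ℝ x (b i) - inner ℝ x₀ (b i)) : ℝ))) := by
    intro n
    have hw : wave (latticePoint b n) x₀ ≠ 0 := Complex.exp_ne_zero _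
    rw [waveCoeff, wave_latticePoint b x₀ x n, Finset.prod_mul_distrib]
    field_simp
  rw [tsum_congr h1, tsum_mul_left, h, Finset.prod_mul_distrib, wave_sum_smul b x₀ x, productCutoff]
  ring

theorem sum_smul_sub_latticePoint (ζ : Fin d → ℝ) (n : Fin d → ℤ) :
    ∑ i, ζ i • b i - latticePoint b n = ∑ i, (ζ i + n i) • b i := by
  rw [latticePoint, ← Finset.sum_sub_distrib]
  refine Finset.sum_congr rfl fun i _ => ?_
  rw [← sub_smul, sub_neg_eq_add]

theorem summable_norm_waveCoeff_mul_pow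
    (hdec : ∀ k, ∃ B, ∀ t, (1 + |t|) ^ k * ‖𝓕 θ t‖ ≤ B) (ζ : Fin d → ℝ) (k : ℕ) :
    Summable fun n => ‖waveCoeff b x₀ θ ζ n‖ * ‖latticePoint b n‖ ^ k := by
  obtain ⟨D, _, hD⟩ := exists_tsum_prod_shifted_int_le d
  obtain ⟨B, hB⟩ := hdec (k + 2)
  set ξ := ∑ i, ζ i • b i with hξ
  set β := ∑ i, ‖b i‖ with hβ
  have hβ0 : 0 ≤ β := Finset.sum_nonneg fun i _ => norm_nonneg _
  refine Summable.of_nonneg_of_le (fun n => by positivity) (fun n => ?_)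
    ((hD ζ).1.mul_left ((‖ξ‖ + β) ^ k * B ^ d))
  have hz : ∀ j, (1 : ℝ) ≤ 1 + |ζ j + n j| := fun j => by linarith [abs_nonneg (ζ j + n j)]
  have h1 : 1 ≤ ∏ i, (1 + |ζ i + n i|) := Finset.one_le_prod fun j _ => hz j
  have h2 : ‖latticePoint b n‖ ≤ (‖ξ‖ + β) * ∏ i, (1 + |ζ i + n i|) := by
    have h3 : ‖latticePoint b n‖ ≤ ‖ξ‖ + ‖ξ - latticePoint b n‖ := by
      rw [norm_sub_rev]
      have := norm_add_le ξ (latticePoint b n - ξ)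
      rwa [add_sub_cancel] at this
    rw [hξ, sum_smul_sub_latticePoint, ← hξ] at h3
    have h4 := norm_sum_smul_le_prod b fun i => ζ i + n i
    have h5 : ‖ξ‖ ≤ ‖ξ‖ * ∏ i, (1 + |ζ i + n i|) := le_mul_of_one_le_right (norm_nonneg _) h1
    rw [add_mul]
    linarith
  have h6 := pow_prod_mul_prod_le (fun t => norm_nonneg (𝓕 θ t)) hB fun i => ζ i + n i
  rw [norm_waveCoeff]
  calc (∏ i, ‖𝓕 θ (ζ i + n i)‖) * ‖latticePoint b n‖ ^ k
      ≤ (∏ i, ‖𝓕 θ (ζ i + n i)‖) * ((‖ξ‖ + β) * ∏ i, (1 + |ζ i + n i|)) ^ k := by gcongr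
    _ = (‖ξ‖ + β) ^ k * ((∏ i, (1 + |ζ i + n i|)) ^ k * ∏ i, ‖𝓕 θ (ζ i + n i)‖) := by
      rw [mul_pow]; ring
    _ ≤ (‖ξ‖ + β) ^ k * (B ^ d * ∏ i, ((1 + |ζ i + n i|) ^ 2)⁻¹) := by gcongr
    _ = _ := by ring

end Expansion

/-! ### Termwise estimates for near and far lattice frequencies. -/

section Localization

open scoped FourierTransform

variable {d : ℕ}

/-- The weight `s`, later `‖ξ‖ ^ p`, is moved inside the plane wave expansion, so a bound for each
lattice frequency suffices. -/
theorem UniformlyBoundedBy.norm_mul_le_of_forall_waveCoeff_le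
    {W : Opens (EuclideanSpace ℝ (Fin d))} {κ : Type*} {g : κ → CompactDistribution W}
    {K : Compacts (EuclideanSpace ℝ (Fin d))} {M : ℕ} {C : ℝ}
    (h : UniformlyBoundedBy (fun p => (g p : SmoothFunctions W →ₗ[ℂ] ℂ)) K M C)
    {b : Fin d → EuclideanSpace ℝ (Fin d)} {x₀ : EuclideanSpace ℝ (Fin d)} {θ : ℝ → ℂ}
    {δ : ℝ} (hδ : δ ≤ 1 / 2) (hθ : ContDiff ℝ ∞ θ) (hθ0 : ∀ x, δ ≤ |x| → θ x = 0)
    (hdec : ∀ k, ∃ B, ∀ t, (1 + |t|) ^ k * ‖𝓕 θ t‖ ≤ B)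
    {O : Set (EuclideanSpace ℝ (Fin d))} (hO : IsOpen O) (hKO : (K : Set _) ⊆ O)
    (hOδ : ∀ x ∈ O, ∀ k : Fin d → ℤ,
      (∀ i, |inner ℝ x (b i) - inner ℝ x₀ (b i) + k i| < δ) → k = 0)
    (ζ : Fin d → ℝ) {F : SmoothFunctions W}
    (hF : ∀ x ∈ W, F x = productCutoff b x₀ θ x * wave (∑ i, ζ i • b i) x) (p : κ)
    {D : ℝ} (hD : (Summable fun n : Fin d → ℤ => ∏ i, ((1 + |ζ i + n i|) ^ 2)⁻¹) ∧
      ∑' n : Fin d → ℤ, ∏ i, ((1 + |ζ i + n i|) ^ 2)⁻¹ ≤ D)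
    {s Y : ℝ} (hs : 0 ≤ s) (hY : 0 ≤ Y)
    (hle : ∀ n, (∏ i, ‖𝓕 θ (ζ i + n i)‖) * ‖fourierCompact (g p) (latticePoint b n)‖ * s
      ≤ Y * ∏ i, ((1 + |ζ i + n i|) ^ 2)⁻¹) :
    ‖g p F‖ * s ≤ Y * D := by
  obtain ⟨B2, hB2⟩ := hdec 2
  have h1 := h.hasSum_wave p (summable_norm_waveCoeff_mul_pow (b := b) (x₀ := x₀) hdec ζ) (F := F)
    (hO.inter W.isOpen) (subset_inter hKO h.1) fun x hx => by
      rw [hF x hx.2]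
      exact tsum_waveCoeff_mul_wave hδ hθ hθ0 hB2 ζ (hOδ x hx.1)
  have h2 := h1.mul_right (s : ℂ)
  have h3 := tsum_of_norm_bounded (hD.1.mul_left Y).hasSum (f := fun n =>
    waveCoeff b x₀ θ ζ n * fourierCompact (g p) (latticePoint b n) * (s : ℂ)) fun n => by
      rw [norm_mul, norm_mul, norm_waveCoeff, Complex.norm_real, Real.norm_of_nonneg hs]
      exact hle n
  rw [h2.tsum_eq, norm_mul, Complex.norm_real, Real.norm_of_nonneg hs, tsum_mul_left] at h3
  exact h3.trans (mul_le_mul_of_nonneg_left hD.2 hY)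

theorem mul_mul_pow_le_of_near {N : ℕ} {f G m x A C Bd P : ℝ} (hf : 0 ≤ f) (hG : 0 ≤ G)
    (hx : 0 ≤ x) (hm : 0 ≤ m) (hxm : x ≤ 2 * m)
    (hGm : G * m ^ N ≤ A * C ^ N * (N.factorial : ℝ)) (hfP : f ≤ Bd * P) :
    f * G * x ^ N ≤ (Bd * A) * (2 * C) ^ N * (N.factorial : ℝ) * P := by
  calc f * G * x ^ N ≤ f * G * (2 * m) ^ N := by gcongr
    _ = f * (2 ^ N * (G * m ^ N)) := by rw [mul_pow]; ring
    _ ≤ (Bd * P) * (2 ^ N * (A * C ^ N * (N.factorial : ℝ))) :=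
      mul_le_mul hfP (mul_le_mul_of_nonneg_left hGm (by positivity)) (by positivity)
        (hf.trans hfP)
    _ = _ := by rw [mul_pow]; ring

/-- Here `y` stands for `‖ξ - μ‖`, which dominates `c * ‖ξ‖`. The decay of the coefficient `f` pays
both for the power `y ^ N` and for the polynomial growth `P₁ ^ M` of `G`. -/
theorem mul_mul_pow_le_of_far {N M : ℕ} {f G x y c P₁ P₂ C₁ C₂ L β Bd : ℝ} (hf : 0 ≤ f)
    (hx : 0 ≤ x) (hc : 0 < c) (hP₁ : 0 ≤ P₁) (hC₂ : 0 ≤ C₂) (hL : 0 ≤ L)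
    (hxy : x ≤ (1 / c) * y) (hG : G ≤ C₂ * (L * P₁) ^ M)
    (hy : y ^ N * (P₁ ^ M * f) ≤ β ^ N * (Bd * (C₁ ^ N * (N.factorial : ℝ)) * P₂)) :
    f * G * x ^ N ≤ (Bd * (C₂ * L ^ M)) * (C₁ * β / c) ^ N * (N.factorial : ℝ) * P₂ := by
  calc f * G * x ^ N ≤ f * (C₂ * (L * P₁) ^ M) * ((1 / c) * y) ^ N :=
        mul_le_mul (mul_le_mul_of_nonneg_left hG hf) (pow_le_pow_left₀ hx hxy N) (by positivity)
          (by positivity)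
    _ = C₂ * L ^ M * (1 / c) ^ N * (y ^ N * (P₁ ^ M * f)) := by
      rw [mul_pow, mul_pow]; ring
    _ ≤ C₂ * L ^ M * (1 / c) ^ N * (β ^ N * (Bd * (C₁ ^ N * (N.factorial : ℝ)) * P₂)) :=
      mul_le_mul_of_nonneg_left hy (by positivity)
    _ = _ := by
      rw [div_pow (C₁ * β), mul_pow C₁, one_div, inv_pow]; ring

theorem mul_pow_mul_le_mul_pow_mul {N : ℕ} {a a' r r' F P : ℝ} (ha' : 0 ≤ a')
    (hr : 0 ≤ r) (hF : 0 ≤ F) (hP : 0 ≤ P) (haa : a ≤ a') (hrr : r ≤ r') :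
    a * r ^ N * F * P ≤ a' * r' ^ N * F * P := by
  gcongr

/-- Termwise estimate: lattice frequencies close to `ξ` are controlled by the decay of `ĝ` in the
cone, the others by the decay of the Fourier transform of the cutoff. -/
theorem waveCoeff_mul_le {d N M : ℕ} (hd : 0 < d) {b : Fin d → EuclideanSpace ℝ (Fin d)}
    {Γ : Set (EuclideanSpace ℝ (Fin d))} {F : ℝ → ℝ} (hF : ∀ t, 0 ≤ F t) {B C₁ : ℝ} (hB : 0 < B)
    (hC₁ : 0 < C₁) (hdec : ∀ t, (1 + |t|) ^ (M + 2) * F t ≤ B)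
    (hdecN : ∀ t, (1 + |t|) ^ (M + 2) * (|t| ^ N * F t) ≤ B * (C₁ ^ N * (N.factorial : ℝ)))
    {c : ℝ} (hc : 0 < c) {A C C₂ : ℝ} (hA : 0 ≤ A) (hC : 0 ≤ C) (hC₂ : 0 ≤ C₂)
    {G : EuclideanSpace ℝ (Fin d) → ℝ} (hG0 : ∀ μ, 0 ≤ G μ)
    (hG : ∀ μ, G μ ≤ C₂ * (1 + 2 * Real.pi * ‖μ‖) ^ M)
    (ζ : Fin d → ℝ) (n : Fin d → ℤ)
    (hGΓ : latticePoint b n ∈ Γ →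
      G (latticePoint b n) * ‖latticePoint b n‖ ^ N ≤ A * C ^ N * (N.factorial : ℝ))
    (hcone : (latticePoint b n ∈ Γ ∧ ‖∑ i, ζ i • b i‖ ≤ 2 * ‖latticePoint b n‖) ∨
      c * ‖∑ i, ζ i • b i‖ ≤ ‖∑ i, ζ i • b i - latticePoint b n‖) :
    (∏ i, F (ζ i + n i)) * G (latticePoint b n) * ‖∑ i, ζ i • b i‖ ^ N
      ≤ (B ^ d * (C₂ * (1 + 2 * Real.pi * ((1 / c + 1) * ∑ i, ‖b i‖)) ^ M + A)) *
        (C₁ * (∑ i, ‖b i‖) / c + 2 * C) ^ N * (N.factorial : ℝ) *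
          ∏ i, ((1 + |ζ i + n i|) ^ 2)⁻¹ := by
  set β := ∑ i, ‖b i‖ with hβ
  have hβ0 : 0 ≤ β := Finset.sum_nonneg fun i _ => norm_nonneg _
  set ξ := ∑ i, ζ i • b i with hξ
  set μ := latticePoint b n with hμ
  set z : Fin d → ℝ := fun i => ζ i + n i with hz
  have hξμ : ξ - μ = ∑ i, z i • b i := sum_smul_sub_latticePoint ζ n
  set P₁ := ∏ i, (1 + |z i|) with hP₁
  set P₂ := ∏ i, ((1 + |z i|) ^ 2)⁻¹ with hP₂
  have hP₂0 : 0 ≤ P₂ := Finset.prod_nonneg fun i _ => by positivity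
  have h1 : 1 ≤ P₁ := Finset.one_le_prod fun j _ => by linarith [abs_nonneg (z j)]
  have hFp : 0 ≤ ∏ i, F (z i) := Finset.prod_nonneg fun i _ => hF _
  set L := 1 + 2 * Real.pi * ((1 / c + 1) * β) with hL
  have hL0 : 0 ≤ L := by positivity
  have hLM : 0 ≤ C₂ * L ^ M := by positivity
  have hBd : 0 ≤ B ^ d := by positivity
  have hβc : 0 ≤ C₁ * β / c := by positivity
  have hC2 : 0 ≤ 2 * C := by positivity
  have hfac : (0 : ℝ) < (N.factorial : ℝ) := by positivity
  change (∏ i, F (z i)) * G μ * ‖ξ‖ ^ N ≤ _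
  rcases hcone with ⟨hΓ, hle⟩ | hfar
  · have h2 : ∏ i, F (z i) ≤ B ^ d * P₂ := by
      refine le_trans ?_ (pow_prod_mul_prod_le hF hdec z)
      exact le_mul_of_one_le_left hFp (one_le_pow₀ h1)
    refine (mul_mul_pow_le_of_near hFp (hG0 μ) (norm_nonneg ξ) (norm_nonneg μ) hle (hGΓ hΓ)
      h2).trans (mul_pow_mul_le_mul_pow_mul (mul_nonneg hBd (add_nonneg hLM hA)) (by assumption)
        hfac.le hP₂0 ?_ ?_)
    · exact mul_le_mul_of_nonneg_left (le_add_of_nonneg_left hLM) hBd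
    · exact le_add_of_nonneg_left hβc
  · have h2 : ‖ξ‖ ≤ (1 / c) * ‖ξ - μ‖ := by
      rw [one_div, ← div_eq_inv_mul, le_div_iff₀ hc, mul_comm]
      exact hfar
    have h3 : ‖μ‖ ≤ (1 / c + 1) * β * P₁ := by
      have h4 : ‖μ‖ ≤ ‖ξ‖ + ‖ξ - μ‖ := by
        rw [norm_sub_rev]
        have := norm_add_le ξ (μ - ξ)
        rwa [add_sub_cancel] at this
      have h5 : ‖ξ - μ‖ ≤ β * P₁ := by
        rw [hξμ]
        exact norm_sum_smul_le_prod b z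
      calc ‖μ‖ ≤ (1 / c + 1) * ‖ξ - μ‖ := by linarith
        _ ≤ (1 / c + 1) * (β * P₁) := by gcongr
        _ = _ := by ring
    have h6 : G μ ≤ C₂ * (L * P₁) ^ M := by
      refine (hG μ).trans ?_
      gcongr
      calc 1 + 2 * Real.pi * ‖μ‖ ≤ P₁ + 2 * Real.pi * ((1 / c + 1) * β * P₁) := by gcongr
        _ = L * P₁ := by rw [hL]; ring
    have h7 : ‖ξ - μ‖ ^ N * (P₁ ^ M * ∏ i, F (z i))
        ≤ β ^ N * (B ^ d * (C₁ ^ N * (N.factorial : ℝ)) * P₂) := by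
      rw [hξμ]
      exact norm_sum_smul_pow_mul_prod_le hd hF hdec hdecN b z
    refine (mul_mul_pow_le_of_far hFp (norm_nonneg ξ) hc (by linarith) hC₂ hL0 h2 h6 h7).trans
      (mul_pow_mul_le_mul_pow_mul (mul_nonneg hBd (add_nonneg hLM hA)) (by assumption)
        hfac.le hP₂0 ?_ ?_)
    · exact mul_le_mul_of_nonneg_left (le_add_of_nonneg_right hA) hBd
    · exact le_add_of_nonneg_right hC2

end Localization

/-! ### The localization principle. -/

section MicrolocalCutoff

open scoped FourierTransform

variable {d : ℕ}

theorem exists_cutoff_scale (b : Module.Basis (Fin d) ℝ (EuclideanSpace ℝ (Fin d)))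
    {W' : Opens (EuclideanSpace ℝ (Fin d))} {x₀ : EuclideanSpace ℝ (Fin d)} (hx₀ : x₀ ∈ W')
    (K : Compacts (EuclideanSpace ℝ (Fin d)))
    (hK : ∀ x ∈ K, ∀ k : Fin d → ℤ, (∀ i, inner ℝ x (b i) - inner ℝ x₀ (b i) = k i) → k = 0) :
    ∃ δ > 0, δ ≤ 1 / 2 ∧ (∃ T : Compacts (EuclideanSpace ℝ (Fin d)), (T : Set (EuclideanSpace ℝ (Fin d))) ⊆ W' ∧
        ∀ x, (∀ i, |inner ℝ x (b i) - inner ℝ x₀ (b i)| ≤ δ) → x ∈ T) ∧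
      ∃ O : Set (EuclideanSpace ℝ (Fin d)), IsOpen O ∧ (K : Set _) ⊆ O ∧
        ∀ x ∈ O, ∀ k : Fin d → ℤ,
          (∀ i, |inner ℝ x (b i) - inner ℝ x₀ (b i) + k i| < δ) → k = 0 := by
  let Y : EuclideanSpace ℝ (Fin d) → Fin d → ℝ := fun x i => inner ℝ x (b i) - inner ℝ x₀ (b i)
  have hY : Continuous Y := continuous_pi fun i =>
    (continuous_id.inner continuous_const).sub continuous_const
  obtain ⟨δ₁, hδ₁, O, hO, hKO, hOk⟩ := exists_separation_from_integers (K.isCompact.image hY) (by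
    rintro _ ⟨x, hx, rfl⟩ k hk
    exact hK x hx k hk)
  obtain ⟨A, hA, hAle⟩ := exists_norm_le_of_abs_inner_le b
  obtain ⟨ε, hε, hεW⟩ := Metric.nhds_basis_closedBall.mem_iff.1 (W'.isOpen.mem_nhds hx₀)
  refine ⟨min (min δ₁ (ε / A)) (1 / 2), by positivity, min_le_right _ _,
    ⟨⟨Metric.closedBall x₀ ε, isCompact_closedBall _ _⟩, hεW, fun x hx => ?_⟩,
    Y ⁻¹' O, hO.preimage hY, image_subset_iff.1 hKO, fun x hx k hk => hOk (Y x) hx k fun i =>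
      (hk i).trans_le ((min_le_left _ _).trans (min_le_left _ _))⟩
  have h1 := hAle (x - x₀) (ε / A) (by positivity) fun i => by
    rw [inner_sub_left]
    exact (hx i).trans ((min_le_left _ _).trans (min_le_right _ _))
  rw [mul_div_cancel₀ _ hA.ne'] at h1
  exact mem_closedBall_iff_norm.2 h1

/-- Up to a fixed order the cutoffs are bounded uniformly in `N`; this keeps the localized sequence
bounded. -/
theorem exists_norm_iteratedFDeriv_productCutoff_le {b : Fin d → EuclideanSpace ℝ (Fin d)}
    {x₀ : EuclideanSpace ℝ (Fin d)} {θ : ℕ → ℝ → ℂ} (hθ : ∀ N, ContDiff ℝ ∞ (θ N))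
    (hB : ∀ j, ∃ B, ∀ N x, ‖iteratedDeriv j (θ N) x‖ ≤ B) (M : ℕ) :
    ∃ B, ∀ N, ∀ j ≤ M, ∀ x, ‖iteratedFDeriv ℝ j (productCutoff b x₀ (θ N)) x‖ ≤ B := by
  choose B hB using hB
  have h := exists_norm_iteratedFDeriv_prod_le
    (F := fun i N (x : EuclideanSpace ℝ (Fin d)) => θ N (inner ℝ x (b i) - inner ℝ x₀ (b i)))
    (fun i N => (hθ N).comp ((contDiff_id.inner ℝ contDiff_const).sub contDiff_const))
    (fun i j => ⟨B j * ‖b i‖ ^ j, fun N x =>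
      norm_iteratedFDeriv_comp_inner_le (hθ N) (b i) _ (fun s => hB j N s) x⟩) Finset.univ
  choose B' hB' using h
  refine ⟨∑ j ∈ Finset.range (M + 1), |B' j|, fun N j hj x => ?_⟩
  refine ((hB' j N x).trans (le_abs_self _)).trans ?_
  exact Finset.single_le_sum (f := fun j => |B' j|) (fun i _ => abs_nonneg _)
    (Finset.mem_range.2 (by omega))

theorem AgreeOn.comp_mulCutoff {Ω W W' V V' : Opens (EuclideanSpace ℝ (Fin d))} {f : 𝓓'(Ω, ℂ)}
    {u : CompactDistribution W} (h : AgreeOn V u f) {χ : EuclideanSpace ℝ (Fin d) → ℂ}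
    (hχ : ContDiff ℝ ∞ χ) (hW' : tsupport χ ⊆ W') (hV : V' ≤ V) (hV' : V' ≤ W')
    (h1 : ∀ x ∈ V', χ x = 1) {G : CompactDistribution W'}
    (hG : ∀ φ, G φ = u (mulCutoff W χ hχ hW' φ)) : AgreeOn V' G f := by
  refine ⟨le_inf hV' (hV.trans (h.1.trans inf_le_right)), fun φ hφ => ?_⟩
  rw [← h.2 φ (hφ.trans hV), hG]
  congr 1
  refine SmoothFunctions.ext fun x => ?_
  change (W : Set _).indicator (fun x => χ x * (W' : Set _).indicator (fun x => (φ x : ℂ)) x) x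
    = (W : Set _).indicator (fun x => (φ x : ℂ)) x
  congr 1
  funext y
  by_cases hy : φ y = 0
  · simp [indicator, hy]
  · have hyV : y ∈ V' := hφ (subset_tsupport _ hy)
    rw [h1 y hyV, one_mul, indicator_of_mem (hV' hyV)]

/-- If `f` is locally represented by a bounded sequence `g` whose Fourier transforms decay
analytically at the lattice points in a cone, and the lattice is fine enough to separate `x₀` from
its dual translates within the support of `g`, then cutting off yields a bounded sequence with
analytic decay at all points of a smaller cone. -/
theorem exists_localized_sequence {Ω W W' : Opens (EuclideanSpace ℝ (Fin d))} {f : 𝓓'(Ω, ℂ)}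
    (b : Module.Basis (Fin d) ℝ (EuclideanSpace ℝ (Fin d))) {x₀ ξ₀ : EuclideanSpace ℝ (Fin d)}
    (hξ₀ : ξ₀ ≠ 0) (hx₀ : x₀ ∈ W') {V : Opens (EuclideanSpace ℝ (Fin d))} (hx₀V : x₀ ∈ V)
    {Γ : Set (EuclideanSpace ℝ (Fin d))} (hΓ : IsOpenConicNhd Γ ξ₀)
    {g : ℕ → CompactDistribution W} {K : Compacts (EuclideanSpace ℝ (Fin d))} {M : ℕ} {C : ℝ}
    (hC : 0 < C)
    (hg : UniformlyBoundedBy (fun p => (g p : SmoothFunctions W →ₗ[ℂ] ℂ)) K M C)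
    (hgf : ∀ p, AgreeOn V (g p) f)
    (hK : ∀ x ∈ K, ∀ k : Fin d → ℤ, (∀ i, inner ℝ x (b i) - inner ℝ x₀ (b i) = k i) → k = 0)
    {A₀ C₀ : ℝ} (hA₀ : 0 < A₀) (hC₀ : 0 < C₀)
    (hdecay : ∀ (p : ℕ) (n : Fin d → ℤ), latticePoint b n ∈ Γ →
      ‖fourierCompact (g p) (latticePoint b n)‖ * ‖latticePoint b n‖ ^ p
        ≤ A₀ * C₀ ^ p * (p.factorial : ℝ)) :
    ∃ (Γ' : Set (EuclideanSpace ℝ (Fin d))) (V' : Opens (EuclideanSpace ℝ (Fin d)))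
      (G : ℕ → CompactDistribution W'),
      IsOpenConicNhd Γ' ξ₀ ∧ x₀ ∈ V' ∧ Bornology.IsVonNBounded ℂ (range G) ∧
      (∀ p, AgreeOn V' (G p) f) ∧
      ∃ A > (0 : ℝ), ∃ C > (0 : ℝ), ∀ p : ℕ, ∀ ξ ∈ Γ',
        ‖fourierCompact (G p) ξ‖ * ‖ξ‖ ^ p ≤ A * C ^ p * (p.factorial : ℝ) := by
  have hd : 0 < d := by
    rcases Nat.eq_zero_or_pos d with rfl | hd
    · exact absurd (Subsingleton.elim ξ₀ 0) hξ₀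
    · exact hd
  obtain ⟨δ, hδ, hδ2, ⟨T, hTW, hT⟩, O, hO, hKO, hOδ⟩ := exists_cutoff_scale b hx₀ K hK
  obtain ⟨r, hr, θ, hθ, hθ0, hθ1, hθB, C₁, hC₁, hθF⟩ := exists_analytic_cutoffs_fourier hδ
  obtain ⟨B, hB⟩ := exists_norm_iteratedFDeriv_productCutoff_le (b := b) (x₀ := x₀) hθ hθB M
  obtain ⟨Γ', c, hΓ', hc, hcone⟩ := exists_smaller_cone hξ₀ hΓ
  obtain ⟨D, hD, hDsum⟩ := exists_tsum_prod_shifted_int_le d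
  -- `M` powers compensate the growth of the transforms of the `g p`, and two make the lattice sum
  -- converge.
  obtain ⟨B', hB', hdec⟩ := hθF (M + 2)
  have hzero : ∀ N x, productCutoff b x₀ (θ N) x ≠ 0 →
      ∀ i, |inner ℝ x (b i) - inner ℝ x₀ (b i)| ≤ δ := by
    intro N x hx i
    by_contra hc
    exact hx (Finset.prod_eq_zero (Finset.mem_univ i) (hθ0 N _ (not_le.1 hc).le))
  have hsupp : ∀ N, tsupport (productCutoff b x₀ (θ N)) ⊆ T := fun N =>
    closure_minimal (fun x hx => hT x (hzero N x hx)) T.isCompact.isClosed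
  have hsm : ∀ N, ContDiff ℝ ∞ (productCutoff b x₀ (θ N)) := fun N => contDiff_productCutoff (hθ N)
  have hloc := hg.comp_mulCutoff hsm hTW hsupp hB
  let G : ℕ → CompactDistribution W' := fun p => ⟨_, hloc.continuous p⟩
  have hG : ∀ p φ, G p φ = g p (mulCutoff W _ (hsm p) ((hsupp p).trans hTW) φ) := fun p φ => rfl
  -- All the cutoffs equal one here, since their plateau radius `r` does not depend on `p`.
  let V₁ : Opens (EuclideanSpace ℝ (Fin d)) :=
    ⟨⋂ i, {x | |inner ℝ x (b i) - inner ℝ x₀ (b i)| < r}, isOpen_iInter_of_finite fun i =>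
      isOpen_lt (((continuous_id.inner continuous_const).sub continuous_const).abs)
        continuous_const⟩
  have hV₁ : ∀ x ∈ V₁, ∀ i, |inner ℝ x (b i) - inner ℝ x₀ (b i)| < r := fun x hx i => by
    have hx' : x ∈ ⋂ i, {x | |inner ℝ x (b i) - inner ℝ x₀ (b i)| < r} := hx
    exact mem_iInter.1 hx' i
  refine ⟨Γ', V ⊓ W' ⊓ V₁, G, hΓ', ⟨⟨hx₀V, hx₀⟩, mem_iInter.2 fun i => by simpa using hr⟩,
    UniformlyBoundedBy.isVonNBounded (g := G) hloc, fun p => ?_, ?_⟩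
  · refine (hgf p).comp_mulCutoff (hsm p) ((hsupp p).trans hTW)
      (inf_le_left.trans inf_le_left) (inf_le_left.trans inf_le_right) (fun x hx => ?_) (hG p)
    exact Finset.prod_eq_one fun i _ => hθ1 p _ (hV₁ x hx.2 i).le
  · set β := ∑ i, ‖b i‖
    refine ⟨(B' ^ d * (C * (1 + 2 * Real.pi * ((1 / c + 1) * β)) ^ M + A₀)) * D, by positivity,
      C₁ * β / c + 2 * C₀, by positivity, fun p ξ hξ => ?_⟩
    have hζ := b.sum_repr ξ
    set ζ : Fin d → ℝ := fun i => b.repr ξ i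
    have hmain := hg.norm_mul_le_of_forall_waveCoeff_le hδ2 (hθ p) (hθ0 p)
      (fun k => (hθF k).imp fun B hB t => (hB.2 p t).1) hO hKO hOδ ζ
      (F := mulCutoff W _ (hsm p) ((hsupp p).trans hTW)
        (SmoothFunctions.restrict W' (wave ξ) (contDiff_wave ξ)))
      (fun x hx => by
        change (W : Set _).indicator (fun x => productCutoff b x₀ (θ p) x *
          (W' : Set _).indicator (wave ξ) x) x = _
        rw [indicator_of_mem hx, hζ]
        by_cases hxW : x ∈ W'
        · rw [indicator_of_mem hxW]
        · have : productCutoff b x₀ (θ p) x = 0 := by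
            by_contra hne
            exact hxW (hTW (hT x (hzero p x hne)))
          rw [this, zero_mul, zero_mul])
      p (hDsum ζ) (s := ‖ξ‖ ^ p)
      (Y := (B' ^ d * (C * (1 + 2 * Real.pi * ((1 / c + 1) * β)) ^ M + A₀)) *
        (C₁ * β / c + 2 * C₀) ^ p * (p.factorial : ℝ)) (by positivity) (by positivity)
      (fun n => by
        have hcn := hcone ξ hξ (latticePoint b n)
        rw [← hζ] at hcn ⊢
        exact waveCoeff_mul_le hd (fun t => norm_nonneg _) hB' hC₁ (fun t => (hdec p t).1)
          (fun t => (hdec p t).2.trans_eq (by ring)) hc hA₀.le hC₀.le hC.le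
          (fun μ => norm_nonneg (fourierCompact (g p) μ)) (hg.norm_fourierCompact_le p) ζ n
          (hdecay p n) hcn)
    rw [fourierCompact_eq, hG]
    exact hmain.trans_eq (by ring)

end MicrolocalCutoff

/-! ### Lattice bases and dual lattices. -/

section Bases

variable {d : ℕ}

theorem latticePoint_mem {Λ : Submodule ℤ (EuclideanSpace ℝ (Fin d))}
    {b : Fin d → EuclideanSpace ℝ (Fin d)} (hb : ∀ i, b i ∈ Λ) (n : Fin d → ℤ) :
    latticePoint b n ∈ Λ := by
  refine Submodule.sum_mem _ fun i _ => ?_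
  have : (-(n i : ℝ)) • b i = (-n i) • b i := by
    rw [← Int.cast_smul_eq_zsmul ℝ, Int.cast_neg]
  rw [this]
  exact Submodule.smul_mem _ _ (hb i)

/-- A lattice in `ℝ^d` is spanned over `ℤ` by a basis of `ℝ^d`. -/
theorem exists_basis_span_eq (Λ : Submodule ℤ (EuclideanSpace ℝ (Fin d)))
    [DiscreteTopology Λ] [IsZLattice ℝ Λ] :
    ∃ b : Module.Basis (Fin d) ℝ (EuclideanSpace ℝ (Fin d)),
      Submodule.span ℤ (range b) = Λ := by
  have := ZLattice.module_finite ℝ Λ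
  have := ZLattice.module_free ℝ Λ
  let b₀ := (Module.Free.chooseBasis ℤ Λ).ofZLatticeBasis ℝ Λ
  have hcard : Fintype.card (Module.Free.ChooseBasisIndex ℤ Λ) = d := by
    rw [← Module.finrank_eq_card_basis b₀, finrank_euclideanSpace_fin]
  refine ⟨b₀.reindex (Fintype.equivFinOfCardEq hcard), ?_⟩
  rw [Module.Basis.range_reindex]
  exact Module.Basis.ofZLatticeBasis_span ℝ Λ _

/-- Integrality of the pairing passes from generators to their integer span, so integer coordinates
of `x - x₀` place it in the dual lattice. -/
theorem mem_dualLattice_of_basis {b : Fin d → EuclideanSpace ℝ (Fin d)}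
    {ν : EuclideanSpace ℝ (Fin d)} {k : Fin d → ℤ} (hk : ∀ i, inner ℝ ν (b i) = k i) :
    ν ∈ dualLattice (Submodule.span ℤ (range b)) := by
  intro μ hμ
  induction hμ using Submodule.span_induction with
  | mem x hx =>
    obtain ⟨i, rfl⟩ := hx
    exact ⟨k i, by rw [real_inner_comm, hk]⟩
  | zero => exact ⟨0, by simp⟩
  | add x y _ _ hx hy =>
    obtain ⟨m, hm⟩ := hx
    obtain ⟨n, hn⟩ := hy
    exact ⟨m + n, by rw [inner_add_left, hm, hn]; push_cast; rfl⟩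
  | smul a x _ hx =>
    obtain ⟨m, hm⟩ := hx
    exact ⟨a * m, by
      rw [← Int.cast_smul_eq_zsmul ℝ, real_inner_smul_left, hm]; push_cast; rfl⟩

/-- A basis so small that the coordinates `(x - x₀)·bᵢ` are less than one on a given compact set. -/
theorem exists_basis_separating (K : Compacts (EuclideanSpace ℝ (Fin d)))
    (x₀ : EuclideanSpace ℝ (Fin d)) :
    ∃ b : Module.Basis (Fin d) ℝ (EuclideanSpace ℝ (Fin d)), ∀ x ∈ K, ∀ k : Fin d → ℤ,
      (∀ i, inner ℝ x (b i) - inner ℝ x₀ (b i) = k i) → k = 0 := by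
  obtain ⟨R, hR, hKR⟩ := K.isCompact.isBounded.exists_pos_norm_le
  set S := R + ‖x₀‖ + 1 with hS
  have hS0 : 0 < S := by positivity
  let b₀ := (EuclideanSpace.basisFun (Fin d) ℝ).toBasis
  refine ⟨b₀.isUnitSMul (w := fun _ => S⁻¹) fun _ => (inv_ne_zero hS0.ne').isUnit,
    fun x hx k hk => funext fun i => ?_⟩
  have h1 := hk i
  rw [Module.Basis.isUnitSMul_apply, ← inner_sub_left, real_inner_smul_right] at h1
  have h2 : |inner ℝ (x - x₀) (b₀ i)| < S := by
    have h3 := abs_real_inner_le_norm (x - x₀) (b₀ i)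
    have h4 : ‖b₀ i‖ = 1 := by simp [b₀]
    rw [h4, mul_one] at h3
    linarith [norm_sub_le x x₀, hKR x hx]
  have h5 : |(k i : ℝ)| < 1 := by
    rw [← h1, abs_mul, abs_of_pos (inv_pos.2 hS0), ← div_eq_inv_mul, div_lt_one hS0]
    exact h2
  have h6 : |k i| < 1 := by exact_mod_cast h5
  simpa using Int.abs_lt_one_iff.1 h6

end Bases

end

theorem theorem1p2 {d : ℕ} (Λ : Submodule ℤ (EuclideanSpace ℝ (Fin d)))
    [DiscreteTopology Λ] [IsZLattice ℝ Λ]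
    (U : Opens (EuclideanSpace ℝ (Fin d))) (hUconv : Convex ℝ (U : Set (EuclideanSpace ℝ (Fin d))))
    (hU : (U : Set (EuclideanSpace ℝ (Fin d))) ∩ dualLattice Λ = {0})
    (Ω : Opens (EuclideanSpace ℝ (Fin d))) (f : 𝓓'(Ω, ℂ)) :
    analyticWaveFrontSet f =
      {z | z.1 ∈ Ω ∧ z.2 ≠ 0} \
      {z | ∃ (V : Opens (EuclideanSpace ℝ (Fin d))) (Γ : Set (EuclideanSpace ℝ (Fin d)))
          (g : ℕ → CompactDistribution (Ω ⊓ translateOpens z.1 U)),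
          z.1 ∈ V ∧ V ≤ Ω ⊓ translateOpens z.1 U ∧ IsOpenConicNhd Γ z.2 ∧
          Bornology.IsVonNBounded ℂ (range g) ∧ (∀ p, AgreeOn V (g p) f) ∧
          ∃ h > (0 : ℝ), ∀ p : ℕ, ∀ μ ∈ Γ ∩ (Λ : Set (EuclideanSpace ℝ (Fin d))),
            ‖fourierCompact (g p) μ‖ * ‖μ‖ ^ p ≤ h ^ (p + 1) * (p.factorial : ℝ)} := by
  ext ⟨x₀, ξ₀⟩
  have h0U : (0 : EuclideanSpace ℝ (Fin d)) ∈ U := by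
    have : (0 : EuclideanSpace ℝ (Fin d)) ∈ (U : Set _) ∩ dualLattice Λ := by
      rw [hU]; exact mem_singleton 0
    exact this.1
  simp only [analyticWaveFrontSet, mem_ofPred_eq, mem_sdiff, and_assoc]
  refine and_congr_right fun hx₀ => and_congr_right fun hξ₀ => not_congr ⟨?_, ?_⟩
  · rintro ⟨Γ, V, g, hΓ, hxV, hg, hgf, A, hA, C, hC, hdecay⟩
    obtain ⟨K, M, C₁, hC₁, hgK⟩ := exists_uniformlyBoundedBy hg
    -- The given `K` need not lie in `x₀ + U`, so `Λ` may fail to separate it. Decay on the whole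
    -- cone allows any auxiliary lattice.
    obtain ⟨b, hb⟩ := exists_basis_separating K x₀
    have hx₀W : x₀ ∈ Ω ⊓ translateOpens x₀ U :=
      ⟨hx₀, mem_vadd_set.2 ⟨0, h0U, by simp⟩⟩
    obtain ⟨Γ', V', G, hΓ', hxV', hG, hGf, A', hA', C', hC', hdecay'⟩ :=
      exists_localized_sequence b hξ₀ hx₀W hxV hΓ hC₁ hgK hgf hb hA hC
        fun p n hn => hdecay p _ hn
    -- The larger of `A'` and `C'` serves as the single constant: `A' * C' ^ p ≤ h * h ^ p`.
    refine ⟨V', Γ', G, hxV', (hGf 0).1.trans inf_le_left, hΓ', hG, hGf, max A' C',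
      lt_max_of_lt_left hA', fun p μ hμ => (hdecay' p μ hμ.1).trans ?_⟩
    rw [pow_succ']
    gcongr
    · exact le_max_left _ _
    · exact le_max_right _ _
  · rintro ⟨V, Γ, g, hxV, -, hΓ, hg, hgf, h, hh, hdecay⟩
    obtain ⟨K, M, C₁, hC₁, hgK⟩ := exists_uniformlyBoundedBy hg
    obtain ⟨b, hb⟩ := exists_basis_span_eq Λ
    have hbΛ : ∀ i, b i ∈ Λ := fun i => hb ▸ Submodule.subset_span (mem_range_self i)
    -- Since `K ⊆ x₀ + U`, a point of `K` whose coordinates relative to `x₀` are integers differs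
    -- from `x₀` by an element of `U ∩ Λ* = {0}`. Both decay constants are `h`, as `h ^ (p + 1) = h
    -- * h ^ p`.
    obtain ⟨Γ', V', G, hΓ', hxV', hG, hGf, A', hA', C', hC', hdecay'⟩ :=
      exists_localized_sequence b hξ₀ hx₀ hxV hΓ hC₁ hgK hgf (fun x hx k hk => by
        have h1 : ∀ i, inner ℝ (x - x₀) (b i) = k i := fun i => by rw [inner_sub_left, hk]
        have h2 : x - x₀ ∈ dualLattice Λ := hb ▸ mem_dualLattice_of_basis h1
        have h3 : x - x₀ ∈ (U : Set _) := by
          obtain ⟨u, hu, hux⟩ := mem_vadd_set.1 (hgK.1 hx).2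
          rw [← hux]
          simpa using hu
        have h4 : x - x₀ = 0 := by
          have : x - x₀ ∈ (U : Set _) ∩ dualLattice Λ := ⟨h3, h2⟩
          rwa [hU] at this
        funext i
        have h5 := h1 i
        rw [h4, inner_zero_left] at h5
        simpa using h5.symm) hh hh
        fun p n hn => by
          rw [← pow_succ']
          exact hdecay p _ ⟨hn, latticePoint_mem hbΛ n⟩
    exact ⟨Γ', V', G, hΓ', hxV', hG, hGf, A', hA', C', hC', hdecay'⟩
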